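/- Let $\mathfrak n$ be a finite-dimensional real Lie algebra, $d\ge 1$, with a basis $Z_1,\dots,Z_p,Y_1,\dots,Y_d,X_1,\dots,X_d$ such that $[\mathfrak n,\mathfrak n]$ is contained in the center $\mathfrak z$ of $\mathfrak n$, $\mathfrak z=\operatorname{span}\{Z_1,\dots,Z_p\}$, $[Y_i,Y_j]=[X_i,X_j]=0$ for all $i,j$, and some linear functional $\ell$ on $\mathfrak n$ has stabilizer $\{W:\ell[W,V]=0\ \forall V\}$ equal to $\mathfrak z$. Let $N=\exp\mathfrak n$ be the connected simply connected Lie group of $\mathfrak n$, with Haar measure $dz\,dy\,dx$ in the coordinates $\exp(\sum z_kZ_k)\exp(\sum y_jY_j)\exp(\sum x_jX_j)$, and let $L$ be its left regular representation on $L^2(N)$. Identify $\lambda\in\mathbb R^p$ with the functional on $\mathfrak n$ given by $\lambda(Z_k)=\lambda_k$, $\lambda(Y_j)=\lambda(X_j)=0$. Let $B(\lambda)=(-\lambda[X_i,Y_j])_{1\le i,j\le d}$, $\Sigma=\{\lambda\in\mathbb R^p:\det B(\lambda)\ne0\}$ and $d\mu(\lambda)=|\det B(\lambda)|\,d\lambda$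 on $\Sigma$. For $\lambda\in\Sigma$ let $\pi_\lambda$ be the irreducible representation of $N$ on $L^2(\mathbb R^d)$ given by $$\pi_\lambda\Big(\exp\big(\textstyle\sum z_kZ_k\big)\exp\big(\sum y_jY_j\big)\exp\big(\sum x_jX_j\big)\Big)F(t)=e^{2\pi i\langle\lambda,z\rangle}e^{2\pi i\langle t,B(\lambda)y\rangle}F(t-x).$$ Let $\mathcal P:L^2(N)\to\int_\Sigma^\oplus L^2(\mathbb R^d)\otimes L^2(\mathbb R^d)\,d\mu(\lambda)$, $\mathcal P\phi=\widehat\phi$, be the Plancherel transform, i.e. the continuous extension of $f\mapsto\big(\int_N f(n)\pi_\lambda(n)\,dn\big)_\lambda$ from $L^1(N)\cap L^2(N)$; here $L^2(\mathbb R^d)\otimes L^2(\mathbb R^d)$ is the space of Hilbert–Schmidt operators on $L^2(\mathbb R^d)$ and $f\otimes u$ is the operator $h\mapsto\langle h,u\rangle f$. For vectors $a\in(0,\infty)^p$ and $q,b\in(0,\infty)^d$ put $$\Gamma_{a,q,b}=\Big\{\prod_{j=1}^{p}\exp\big(\tfrac{m_j}{a_j}Z_j\big)\prod_{j=1}^d\exp\big(\tfrac{k_j}{q_j}Y_j\big)\prod_{j=1}^d\exp\big(\tfrac{n_j}{b_j}X_j\big):m_j,k_j,n_j\in\mathbb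 Z\Big\},$$ $D(q)=\operatorname{diag}(1/q_1,\dots,1/q_d)$ and $A(b)=\operatorname{diag}(1/b_1,\dots,1/b_d)$. Fix $a$ and $q$, let $I\subseteq\{\lambda\in\Sigma:0\le\lambda_k\le a_k\text{ for all }k\}$ be measurable and nonempty, let $s=\sup_{\lambda\in I}|\det B(\lambda)|$ and $b(s)=(s^{1/d},\dots,s^{1/d})$. Let $u\in L^2(\mathbb R^d)$ be a unit vector and let $$\mathcal H=\mathcal P^{-1}\Big(\int_I^\oplus L^2(\mathbb R^d)\otimes u\;d\mu(\lambda)\Big)\subseteq L^2(N).$$ For $\lambda\in I$ let $g(\lambda)\in L^2(\mathbb R^d)$ be such that, for $\mu$-a.e. $\lambda\in I$, the Gabor system $$\big\{t\mapsto e^{2\pi i\langle B(\lambda)D(q)k,\,t\rangle}\,g(\lambda)\big(t-A(b(s))n\big):k,n\in\mathbb Z^d\big\}$$ is a Parseval frame of $L^2(\mathbb R^d)$, and let $\eta\in\mathcal H$ satisfy $$\widehat\eta(\lambda)=\frac{g(\lambda)\otimes u}{\prod_{k=1}^{p}\sqrt{a_k}\;|\det B(\lambda)|^{1/2}}\qquad\text{for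 }\mu\text{-a.e. }\lambda\in I.$$ Then: 1. $\{L(\gamma)\eta:\gamma\in\Gamma_{a,q,b(s)}\}$ is a Parseval frame of $\mathcal H$. 2. If $\mu(I)=\dfrac{\prod_{k=1}^{p}a_k}{|\det D(q)\det A(b(s))|}$, then $\{L(\gamma)\eta:\gamma\in\Gamma_{a,q,b(s)}\}$ is an orthonormal basis of $\mathcal H$. -/

import Mathlib

open MeasureTheory
open scoped ENNReal Matrix

noncomputable section

namespace BandLimited

/-! ### Hilbert space preliminaries -/

/-- `(f i)` is a Parseval frame of the subspace `K`: all members lie in `K`, and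
`∑ |⟨v, f i⟩|² = ‖v‖²` (a convergent sum) for every `v` in `K`. -/
def IsParsevalFrame {ι E : Type*} [NormedAddCommGroup E] [InnerProductSpace ℂ E]
    (f : ι → E) (K : Submodule ℂ E) : Prop :=
  (∀ i, f i ∈ K) ∧ ∀ v ∈ K, HasSum (fun i => ‖inner ℂ v (f i)‖ ^ 2) (‖v‖ ^ 2)

/-- `(f i)` is an orthonormal basis of the subspace `K`: it is orthonormal and its closed
linear span is `K`. -/
def IsONB {ι E : Type*} [NormedAddCommGroup E] [InnerProductSpace ℂ E]
    (f : ι → E) (K : Submodule ℂ E) : Prop :=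
  Orthonormal ℂ f ∧ (Submodule.span ℂ (Set.range f)).topologicalClosure = K

/-- `L²(ℝᵈ)`, for Lebesgue measure. -/
abbrev L2R (d : ℕ) : Type := Lp ℂ 2 (volume : Measure (Fin d → ℝ))

/-- `L²(ℝᵈ) ⊗ L²(ℝᵈ)`, the Hilbert space of Hilbert–Schmidt operators on `L²(ℝᵈ)`, each operator
`T h (t) = ∫ k(t, s) h(s) ds` being given by its kernel `k` in `L²(ℝᵈ × ℝᵈ)`
(so that the Hilbert–Schmidt norm is the `L²` norm of the kernel). -/
abbrev HS (d : ℕ) : Type := Lp ℂ 2 (volume : Measure ((Fin d → ℝ) × (Fin d → ℝ)))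

theorem memLp_tensor {d : ℕ} (f u : L2R d) :
    MemLp (fun p : (Fin d → ℝ) × (Fin d → ℝ) => f p.1 * (starRingEnd ℂ) (u p.2)) 2 volume := by
  have hm : AEStronglyMeasurable
      (fun p : (Fin d → ℝ) × (Fin d → ℝ) => f p.1 * (starRingEnd ℂ) (u p.2)) volume :=
    ((Lp.stronglyMeasurable f).comp_measurable measurable_fst).aestronglyMeasurable.mul
      (Complex.continuous_conj.comp_aestronglyMeasurable
        ((Lp.stronglyMeasurable u).comp_measurable measurable_snd).aestronglyMeasurable)
  rw [memLp_two_iff_integrable_sq_norm hm]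
  have hf := (memLp_two_iff_integrable_sq_norm (Lp.aestronglyMeasurable f)).1 (Lp.memLp f)
  have hu := (memLp_two_iff_integrable_sq_norm (Lp.aestronglyMeasurable u)).1 (Lp.memLp u)
  refine (hf.mul_prod hu).congr (Filter.Eventually.of_forall fun p => ?_)
  simp [mul_pow]

/-- The rank one operator `f ⊗ u : h ↦ ⟨h, u⟩ f`, whose kernel is `f(t) * conj (u(s))`. -/
def tensor {d : ℕ} (f u : L2R d) : HS d := (memLp_tensor f u).toLp _

theorem tensor_add {d : ℕ} (f g u : L2R d) : tensor (f + g) u = tensor f u + tensor g u := by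
  rw [tensor, tensor, tensor, ← MemLp.toLp_add]
  refine MemLp.toLp_congr _ _ ?_
  have h := (Measure.quasiMeasurePreserving_fst
    (μ := (volume : Measure (Fin d → ℝ))) (ν := (volume : Measure (Fin d → ℝ)))).ae
      (Lp.coeFn_add f g)
  filter_upwards [h] with p hp
  rw [hp]
  simp [add_mul]

theorem tensor_smul {d : ℕ} (c : ℂ) (f u : L2R d) : tensor (c • f) u = c • tensor f u := by
  rw [tensor, tensor, ← MemLp.toLp_const_smul]
  refine MemLp.toLp_congr _ _ ?_
  have h := (Measure.quasiMeasurePreserving_fst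
    (μ := (volume : Measure (Fin d → ℝ))) (ν := (volume : Measure (Fin d → ℝ)))).ae
      (Lp.coeFn_smul c f)
  filter_upwards [h] with p hp
  rw [hp]
  simp [mul_assoc]

/-- The subspace `L²(ℝᵈ) ⊗ u` of `L²(ℝᵈ) ⊗ L²(ℝᵈ)`. -/
def tensorRange {d : ℕ} (u : L2R d) : Submodule ℂ (HS d) where
  carrier := Set.range fun f => tensor f u
  zero_mem' := ⟨0, by simpa using tensor_smul (0 : ℂ) (0 : L2R d) u⟩
  add_mem' := by
    rintro _ _ ⟨f, rfl⟩ ⟨g, rfl⟩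
    exact ⟨f + g, tensor_add f g u⟩
  smul_mem' := by
    rintro c _ ⟨f, rfl⟩
    exact ⟨c • f, tensor_smul c f u⟩

/-! ### Time-frequency shifts and Gabor systems -/

theorem memLp_timeFreq {d : ℕ} (ω x : Fin d → ℝ) (F : L2R d) :
    MemLp (fun t : Fin d → ℝ =>
      Complex.exp (((2 * Real.pi * (t ⬝ᵥ ω) : ℝ) : ℂ) * Complex.I) * F (t - x)) 2 volume := by
  have h1 : MemLp (fun t : Fin d → ℝ => F (t - x)) 2 volume :=
    (Lp.memLp F).comp_measurePreserving (measurePreserving_sub_right volume x)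
  have hc : Continuous fun t : Fin d → ℝ =>
      Complex.exp (((2 * Real.pi * (t ⬝ᵥ ω) : ℝ) : ℂ) * Complex.I) := by
    unfold dotProduct
    fun_prop
  refine h1.congr_norm (hc.aestronglyMeasurable.mul h1.1)
    (Filter.Eventually.of_forall fun t => ?_)
  rw [norm_mul, Complex.norm_exp_ofReal_mul_I, one_mul]

/-- The function `t ↦ e^{2πi⟨t, ω⟩} F(t - x)` in `L²(ℝᵈ)`. -/
def timeFreq {d : ℕ} (ω x : Fin d → ℝ) (F : L2R d) : L2R d := (memLp_timeFreq ω x F).toLp _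

/-- The Gabor system `G(g, Aℤᵈ × Bℤᵈ) = {e^{2πi⟨Bk, t⟩} g(t - An) : k, n ∈ ℤᵈ}`. -/
def gaborSystem {d : ℕ} (g : L2R d) (A B : Matrix (Fin d) (Fin d) ℝ) :
    (Fin d → ℤ) × (Fin d → ℤ) → L2R d :=
  fun kn => timeFreq (B *ᵥ fun j => (kn.1 j : ℝ)) (A *ᵥ fun j => (kn.2 j : ℝ)) g

/-! ### The class of two-step nilpotent Lie algebras and their groups -/

/-- A Lie algebra `𝔫` of the class considered, with the fixed basis
`Z₁, …, Z_p, Y₁, …, Y_d, X₁, …, X_d` (so `p = n - 2d`). The last condition is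
square-integrability modulo the center: some (equivalently, the generic) linear functional `ℓ`
on `𝔫` has the center as its stabilizer `{w : ℓ[w, v] = 0 for all v}`. -/
structure NilpotentAlgebra (p d : ℕ) (𝔫 : Type*) [LieRing 𝔫] [LieAlgebra ℝ 𝔫] where
  /-- the fixed basis -/
  basis : Module.Basis (Fin p ⊕ Fin d ⊕ Fin d) ℝ 𝔫
  lie_mem_center : ∀ v w : 𝔫, ⁅v, w⁆ ∈ LieAlgebra.center ℝ 𝔫
  center_eq_span : (LieAlgebra.center ℝ 𝔫).toSubmodule =
    Submodule.span ℝ (Set.range fun k : Fin p => basis (Sum.inl k))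
  lie_Y_Y : ∀ i j : Fin d, ⁅basis (Sum.inr (Sum.inl i)), basis (Sum.inr (Sum.inl j))⁆ = 0
  lie_X_X : ∀ i j : Fin d, ⁅basis (Sum.inr (Sum.inr i)), basis (Sum.inr (Sum.inr j))⁆ = 0
  exists_stabilizer_eq_center : ∃ ℓ : 𝔫 →ₗ[ℝ] ℝ,
    ∀ w : 𝔫, (∀ v : 𝔫, ℓ ⁅w, v⁆ = 0) → w ∈ LieAlgebra.center ℝ 𝔫

variable {p d : ℕ} {𝔫 : Type*} [LieRing 𝔫] [LieAlgebra ℝ 𝔫]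

namespace NilpotentAlgebra

/-- The basis vectors `Z_k` of the center. -/
def Z (D : NilpotentAlgebra p d 𝔫) (k : Fin p) : 𝔫 := D.basis (Sum.inl k)

/-- The basis vectors `Y_j`. -/
def Y (D : NilpotentAlgebra p d 𝔫) (j : Fin d) : 𝔫 := D.basis (Sum.inr (Sum.inl j))

/-- The basis vectors `X_j`. -/
def X (D : NilpotentAlgebra p d 𝔫) (j : Fin d) : 𝔫 := D.basis (Sum.inr (Sum.inr j))

/-- `∑ z_k Z_k`. -/
def sumZ (D : NilpotentAlgebra p d 𝔫) (z : Fin p → ℝ) : 𝔫 := ∑ k, z k • D.Z k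

/-- `∑ y_j Y_j`. -/
def sumY (D : NilpotentAlgebra p d 𝔫) (y : Fin d → ℝ) : 𝔫 := ∑ j, y j • D.Y j

/-- `∑ x_j X_j`. -/
def sumX (D : NilpotentAlgebra p d 𝔫) (x : Fin d → ℝ) : 𝔫 := ∑ j, x j • D.X j

/-- The coordinates of a vector along `Z₁, …, Z_p`. -/
def coordZ (D : NilpotentAlgebra p d 𝔫) : 𝔫 →ₗ[ℝ] (Fin p → ℝ) :=
  LinearMap.pi fun k => D.basis.coord (Sum.inl k)

/-- The coordinates of a vector along `Y₁, …, Y_d`. -/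
def coordY (D : NilpotentAlgebra p d 𝔫) : 𝔫 →ₗ[ℝ] (Fin d → ℝ) :=
  LinearMap.pi fun j => D.basis.coord (Sum.inr (Sum.inl j))

/-- The coordinates of a vector along `X₁, …, X_d`. -/
def coordX (D : NilpotentAlgebra p d 𝔫) : 𝔫 →ₗ[ℝ] (Fin d → ℝ) :=
  LinearMap.pi fun j => D.basis.coord (Sum.inr (Sum.inr j))

/-- A point `λ ∈ ℝᵖ` as the linear functional `(λ₁, …, λ_p, 0, …, 0)` on `𝔫`. -/
def functional (D : NilpotentAlgebra p d 𝔫) (l : Fin p → ℝ) : 𝔫 →ₗ[ℝ] ℝ :=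
  ∑ k, l k • D.basis.coord (Sum.inl k)

/-- The matrix `B(λ)`, with entries `-λ[X_i, Y_j]`. -/
def B (D : NilpotentAlgebra p d 𝔫) (l : Fin p → ℝ) : Matrix (Fin d) (Fin d) ℝ :=
  Matrix.of fun i j => -D.functional l ⁅D.X i, D.Y j⁆

/-- The cross-section `Σ` of the generic coadjoint orbits, inside `𝔷* = ℝᵖ`. -/
def crossSection (D : NilpotentAlgebra p d 𝔫) : Set (Fin p → ℝ) := {l | (D.B l).det ≠ 0}

/-- The Plancherel measure `dμ(λ) = |det B(λ)| dλ` on `Σ`. -/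
def plancherelMeasure (D : NilpotentAlgebra p d 𝔫) : Measure (Fin p → ℝ) :=
  (volume.restrict D.crossSection).withDensity fun l => ENNReal.ofReal |(D.B l).det|

end NilpotentAlgebra

/-- The connected simply connected Lie group `N = exp 𝔫`: its elements are `exp v`, `v ∈ 𝔫`, and
the product is given by the Baker–Campbell–Hausdorff formula, which for a two-step
algebra reads `exp v * exp w = exp (v + w + [v, w] / 2)`. -/
@[ext]
structure ExpGroup (D : NilpotentAlgebra p d 𝔫) where
  /-- the exponential map -/
  exp ::
  /-- the logarithm -/
  log : 𝔫

namespace ExpGroup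

variable (D : NilpotentAlgebra p d 𝔫)

instance : Mul (ExpGroup D) := ⟨fun g h => exp (g.log + h.log + (1 / 2 : ℝ) • ⁅g.log, h.log⁆)⟩
instance : One (ExpGroup D) := ⟨exp 0⟩
instance : Inv (ExpGroup D) := ⟨fun g => exp (-g.log)⟩

variable {D}

theorem log_mul (g h : ExpGroup D) :
    (g * h).log = g.log + h.log + (1 / 2 : ℝ) • ⁅g.log, h.log⁆ := rfl

theorem log_one : (1 : ExpGroup D).log = 0 := rfl

theorem log_inv (g : ExpGroup D) : (g⁻¹).log = -g.log := rfl

theorem lie_lie_left (D : NilpotentAlgebra p d 𝔫) (u v w : 𝔫) : ⁅u, ⁅v, w⁆⁆ = 0 :=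
  (LieModule.mem_maxTrivSubmodule ℝ 𝔫 𝔫 _).1 (D.lie_mem_center v w) u

theorem lie_lie_right (D : NilpotentAlgebra p d 𝔫) (u v w : 𝔫) : ⁅⁅v, w⁆, u⁆ = 0 := by
  rw [← lie_skew, lie_lie_left D, neg_zero]

instance : Group (ExpGroup D) :=
  Group.ofLeftAxioms
    (fun a b c => by
      ext
      simp only [log_mul, add_lie, lie_add, lie_smul, smul_lie, lie_lie_left D,
        lie_lie_right D, smul_zero, add_zero, smul_add]
      abel)
    (fun a => by ext; simp [log_mul, log_one])
    (fun a => by ext; simp [log_mul, log_one, log_inv])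

theorem coordZ_sumZ (z) : D.coordZ (D.sumZ z) = z := by
  ext k
  simp [NilpotentAlgebra.coordZ, NilpotentAlgebra.sumZ, NilpotentAlgebra.Z,
    Finsupp.single_apply]

theorem coordZ_sumY (y) : D.coordZ (D.sumY y) = 0 := by
  ext k
  simp [NilpotentAlgebra.coordZ, NilpotentAlgebra.sumY, NilpotentAlgebra.Y]

theorem coordZ_sumX (x) : D.coordZ (D.sumX x) = 0 := by
  ext k
  simp [NilpotentAlgebra.coordZ, NilpotentAlgebra.sumX, NilpotentAlgebra.X]

theorem coordY_sumZ (z) : D.coordY (D.sumZ z) = 0 := by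
  ext k
  simp [NilpotentAlgebra.coordY, NilpotentAlgebra.sumZ, NilpotentAlgebra.Z]

theorem coordY_sumY (y) : D.coordY (D.sumY y) = y := by
  ext k
  simp [NilpotentAlgebra.coordY, NilpotentAlgebra.sumY, NilpotentAlgebra.Y,
    Finsupp.single_apply]

theorem coordY_sumX (x) : D.coordY (D.sumX x) = 0 := by
  ext k
  simp [NilpotentAlgebra.coordY, NilpotentAlgebra.sumX, NilpotentAlgebra.X]

theorem coordX_sumZ (z) : D.coordX (D.sumZ z) = 0 := by
  ext k
  simp [NilpotentAlgebra.coordX, NilpotentAlgebra.sumZ, NilpotentAlgebra.Z]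

theorem coordX_sumY (y) : D.coordX (D.sumY y) = 0 := by
  ext k
  simp [NilpotentAlgebra.coordX, NilpotentAlgebra.sumY, NilpotentAlgebra.Y]

theorem coordX_sumX (x) : D.coordX (D.sumX x) = x := by
  ext k
  simp [NilpotentAlgebra.coordX, NilpotentAlgebra.sumX, NilpotentAlgebra.X,
    Finsupp.single_apply]

theorem sum_coord (v : 𝔫) :
    D.sumZ (D.coordZ v) + D.sumY (D.coordY v) + D.sumX (D.coordX v) = v := by
  conv_rhs => rw [← D.basis.sum_repr v, Fintype.sum_sum_type, Fintype.sum_sum_type]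
  simp [NilpotentAlgebra.sumZ, NilpotentAlgebra.sumY,
    NilpotentAlgebra.sumX, NilpotentAlgebra.Z, NilpotentAlgebra.Y, NilpotentAlgebra.X,
    NilpotentAlgebra.coordZ, NilpotentAlgebra.coordY, NilpotentAlgebra.coordX, add_assoc]

theorem sumZ_mem_center (z) : D.sumZ z ∈ LieAlgebra.center ℝ 𝔫 := by
  rw [← LieSubmodule.mem_toSubmodule, D.center_eq_span]
  exact Submodule.sum_mem _ fun k _ =>
    Submodule.smul_mem _ _ (Submodule.subset_span ⟨k, rfl⟩)

theorem lie_sumZ (v : 𝔫) (z) : ⁅v, D.sumZ z⁆ = 0 :=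
  (LieModule.mem_maxTrivSubmodule ℝ 𝔫 𝔫 _).1 (sumZ_mem_center z) v

theorem sumZ_lie (v : 𝔫) (z) : ⁅D.sumZ z, v⁆ = 0 := by
  rw [← lie_skew, lie_sumZ, neg_zero]

theorem lie_sumY_sumY (y y') : ⁅D.sumY y, D.sumY y'⁆ = 0 := by
  simp [NilpotentAlgebra.sumY, NilpotentAlgebra.Y, sum_lie, lie_sum,
    D.lie_Y_Y]

theorem lie_sumX_sumX (x x') : ⁅D.sumX x, D.sumX x'⁆ = 0 := by
  simp [NilpotentAlgebra.sumX, NilpotentAlgebra.X, sum_lie, lie_sum,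
    D.lie_X_X]

theorem sumZ_coordZ_lie (v w : 𝔫) : D.sumZ (D.coordZ ⁅v, w⁆) = ⁅v, w⁆ := by
  have h := D.lie_mem_center v w
  generalize ⁅v, w⁆ = x at h ⊢
  rw [← LieSubmodule.mem_toSubmodule, D.center_eq_span] at h
  induction h using Submodule.span_induction with
  | mem x hx =>
    obtain ⟨k, rfl⟩ := hx
    have : D.basis (Sum.inl k) = D.sumZ (Pi.single k 1) := by
      simp [NilpotentAlgebra.sumZ, NilpotentAlgebra.Z, Pi.single_apply, ite_smul]
    simp only [this, coordZ_sumZ]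
  | zero => simp [NilpotentAlgebra.sumZ]
  | add x y _ _ hx hy =>
    rw [map_add]
    conv_rhs => rw [← hx, ← hy]
    simp [NilpotentAlgebra.sumZ, add_smul, Finset.sum_add_distrib]
  | smul c x _ hx =>
    rw [map_smul]
    conv_rhs => rw [← hx]
    simp [NilpotentAlgebra.sumZ, mul_smul, Finset.smul_sum]

variable (D)

/-- The point `exp(∑ z_k Z_k) exp(∑ y_j Y_j) exp(∑ x_j X_j)` of `N`. -/
def mk3 (c : (Fin p → ℝ) × (Fin d → ℝ) × (Fin d → ℝ)) : ExpGroup D :=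
  exp (D.sumZ c.1) * exp (D.sumY c.2.1) * exp (D.sumX c.2.2)

variable {D}

theorem log_mk3 (c) : (mk3 D c).log = D.sumZ c.1 + D.sumY c.2.1 + D.sumX c.2.2 +
    (1 / 2 : ℝ) • ⁅D.sumY c.2.1, D.sumX c.2.2⁆ := by
  simp [mk3, log_mul, sumZ_lie]

variable (D)

/-- The coordinates `(z, y, x)` of a point
`exp(∑ z_k Z_k) exp(∑ y_j Y_j) exp(∑ x_j X_j)` of `N`. -/
def coords : ExpGroup D ≃ (Fin p → ℝ) × (Fin d → ℝ) × (Fin d → ℝ) where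
  toFun g := (D.coordZ g.log -
      (1 / 2 : ℝ) • D.coordZ ⁅D.sumY (D.coordY g.log), D.sumX (D.coordX g.log)⁆,
    D.coordY g.log, D.coordX g.log)
  invFun := mk3 D
  left_inv g := by
    ext
    have h := sum_coord (D := D) g.log
    set w := ⁅D.sumY (D.coordY g.log), D.sumX (D.coordX g.log)⁆ with hw
    have e : D.sumZ (D.coordZ g.log - (1 / 2 : ℝ) • D.coordZ w) =
        D.sumZ (D.coordZ g.log) - (1 / 2 : ℝ) • w := by
      conv_rhs => rw [hw, ← sumZ_coordZ_lie (D := D), ← hw]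
      simp only [NilpotentAlgebra.sumZ, Pi.sub_apply, Pi.smul_apply, sub_smul,
        Finset.sum_sub_distrib, Finset.smul_sum, smul_assoc]
    rw [log_mk3]
    simp only
    rw [e, ← hw]
    conv_rhs => rw [← h]
    abel
  right_inv c := by
    have e1 : D.coordY (mk3 D c).log = c.2.1 := by
      rw [log_mk3, ← sumZ_coordZ_lie (D := D)]
      simp [coordY_sumZ, coordY_sumY, coordY_sumX]
    have e2 : D.coordX (mk3 D c).log = c.2.2 := by
      rw [log_mk3, ← sumZ_coordZ_lie (D := D)]
      simp [coordX_sumZ, coordX_sumY, coordX_sumX]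
    have e3 : D.coordZ (mk3 D c).log = c.1 +
        (1 / 2 : ℝ) • D.coordZ ⁅D.sumY c.2.1, D.sumX c.2.2⁆ := by
      rw [log_mk3]
      simp [coordZ_sumZ, coordZ_sumY, coordZ_sumX]
    simp only [e1, e2, e3, add_sub_cancel_right]

theorem coords_mul (g h : ExpGroup D) : coords D (g * h) =
    ((coords D g).1 + (coords D h).1 +
        D.coordZ ⁅D.sumX (coords D g).2.2, D.sumY (coords D h).2.1⁆,
      (coords D g).2.1 + (coords D h).2.1, (coords D g).2.2 + (coords D h).2.2) := by
  obtain ⟨c, rfl⟩ := (coords D).symm.surjective g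
  obtain ⟨c', rfl⟩ := (coords D).symm.surjective h
  simp only [Equiv.apply_symm_apply]
  rw [← Equiv.eq_symm_apply]
  change mk3 D c * mk3 D c' = mk3 D _
  ext
  have eZ : D.sumZ (c.1 + c'.1 + D.coordZ ⁅D.sumX c.2.2, D.sumY c'.2.1⁆) =
      D.sumZ c.1 + D.sumZ c'.1 + ⁅D.sumX c.2.2, D.sumY c'.2.1⁆ := by
    conv_rhs => rw [← sumZ_coordZ_lie (D := D)]
    simp [NilpotentAlgebra.sumZ, add_smul, Finset.sum_add_distrib]
  have eY : D.sumY (c.2.1 + c'.2.1) = D.sumY c.2.1 + D.sumY c'.2.1 := by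
    simp [NilpotentAlgebra.sumY, add_smul, Finset.sum_add_distrib]
  have eX : D.sumX (c.2.2 + c'.2.2) = D.sumX c.2.2 + D.sumX c'.2.2 := by
    simp [NilpotentAlgebra.sumX, add_smul, Finset.sum_add_distrib]
  rw [log_mul, log_mk3, log_mk3, log_mk3]
  simp only
  rw [eZ, eY, eX]
  simp only [add_lie, lie_add, lie_smul, smul_lie, lie_lie_left D, lie_lie_right D,
    sumZ_lie, lie_sumZ, lie_sumY_sumY, lie_sumX_sumX, smul_zero, add_zero, zero_add, smul_add]
  rw [← lie_skew (D.sumY c'.2.1) (D.sumX c.2.2)]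
  module

instance : TopologicalSpace (ExpGroup D) := TopologicalSpace.induced (coords D) inferInstance
instance : MeasurableSpace (ExpGroup D) := borel _
instance : BorelSpace (ExpGroup D) := ⟨rfl⟩

/-- The coordinates as a homeomorphism. -/
def coordsHomeo : ExpGroup D ≃ₜ (Fin p → ℝ) × (Fin d → ℝ) × (Fin d → ℝ) :=
  (coords D).toHomeomorphOfIsInducing ⟨rfl⟩

/-- The coordinates as a measurable equivalence. -/
def coordsMeas : ExpGroup D ≃ᵐ (Fin p → ℝ) × (Fin d → ℝ) × (Fin d → ℝ) :=
  (coordsHomeo D).toMeasurableEquiv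

/-- The canonical Haar measure of `N`: Lebesgue measure in the coordinates `(z, y, x)`. -/
def haar : Measure (ExpGroup D) := Measure.map (coordsMeas D).symm volume

theorem measurePreserving_coords : MeasurePreserving (coordsMeas D) (haar D) volume :=
  ((coordsMeas D).symm.measurable.measurePreserving volume).symm (coordsMeas D).symm

theorem measurePreserving_mul_left (g : ExpGroup D) :
    MeasurePreserving (fun h => g * h) (haar D) (haar D) := by
  set c := coords D g with hc
  have hβ : Continuous fun y : (Fin d → ℝ) => D.coordZ ⁅D.sumX c.2.2, D.sumY y⁆ := by
    simp only [NilpotentAlgebra.sumY, lie_sum, map_sum, lie_smul, map_smul]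
    fun_prop
  have key : MeasurePreserving
      (fun v : ((Fin d → ℝ) × (Fin d → ℝ)) × (Fin p → ℝ) =>
        ((c.2.1 + v.1.1, c.2.2 + v.1.2),
          c.1 + D.coordZ ⁅D.sumX c.2.2, D.sumY v.1.1⁆ + v.2)) volume volume := by
    have h1 : MeasurePreserving
        (fun v : (Fin d → ℝ) × (Fin d → ℝ) => (c.2.1 + v.1, c.2.2 + v.2)) volume volume :=
      (measurePreserving_add_left volume c.2.1).prod (measurePreserving_add_left volume c.2.2)
    refine h1.skew_product
      (g := fun v z => c.1 + D.coordZ ⁅D.sumX c.2.2, D.sumY v.1⁆ + z) ?_ ?_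
    · refine Continuous.measurable ?_
      exact (continuous_const.add (hβ.comp (continuous_fst.comp continuous_fst))).add
        continuous_snd
    · exact Filter.Eventually.of_forall fun v => (measurePreserving_add_left volume _).map_eq
  have hs1 : MeasurePreserving
      (Prod.swap : (Fin p → ℝ) × ((Fin d → ℝ) × (Fin d → ℝ)) → _) volume volume :=
    Measure.measurePreserving_swap
  have hs2 : MeasurePreserving
      (Prod.swap : ((Fin d → ℝ) × (Fin d → ℝ)) × (Fin p → ℝ) → _) volume volume :=
    Measure.measurePreserving_swap
  have hsymm : MeasurePreserving (coordsMeas D).symm volume (haar D) :=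
    (coordsMeas D).symm.measurable.measurePreserving volume
  convert hsymm.comp (hs2.comp (key.comp (hs1.comp (measurePreserving_coords D)))) using 1
  funext h
  change g * h = (coords D).symm _
  rw [Equiv.eq_symm_apply, coords_mul]
  change _ = (c.1 + D.coordZ ⁅D.sumX c.2.2, D.sumY (coords D h).2.1⁆ + (coords D h).1,
    c.2.1 + (coords D h).2.1, c.2.2 + (coords D h).2.2)
  rw [add_right_comm]

/-- `L²(N)`. -/
abbrev L2N : Type _ := Lp ℂ 2 (haar D)

/-- The left regular representation, `(L(g) φ)(x) = φ(g⁻¹ x)`. -/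
def leftRegular (g : ExpGroup D) : L2N D →ₗᵢ[ℂ] L2N D :=
  Lp.compMeasurePreservingₗᵢ ℂ (fun h => g⁻¹ * h) (measurePreserving_mul_left D g⁻¹)

/-- The irreducible representation `π_λ` in its realization on `L²(ℝᵈ)`: for
`n = exp(∑ z_k Z_k) exp(∑ y_j Y_j) exp(∑ x_j X_j)`,
`(π_λ(n) F)(t) = e^{2πi⟨λ, z⟩} e^{2πi⟨t, B(λ) y⟩} F(t - x)`. -/
def rep (l : Fin p → ℝ) (n : ExpGroup D) (F : L2R d) : L2R d :=
  Complex.exp (((2 * Real.pi * (l ⬝ᵥ (coords D n).1) : ℝ) : ℂ) * Complex.I) •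
    timeFreq (D.B l *ᵥ (coords D n).2.1) (coords D n).2.2 F

/-- The Hilbert–Schmidt operator `T` with kernel `k` is the operator-valued Fourier transform
`∫_N f(n) π_λ(n) dn` of `f` at `λ`, the integral being taken in the weak sense:
`⟨T h, h'⟩ = ∫_N f(n) ⟨π_λ(n) h, h'⟩ dn` for all `h, h'`. The left-hand side is written as the
Hilbert–Schmidt inner product of `T` with the rank one operator `h' ⊗ h`. (Mathlib's inner
products are conjugate linear in the first variable.) -/
def IsFourierAt (f : ExpGroup D → ℂ) (l : Fin p → ℝ) (k : HS d) : Prop :=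
  ∀ h h' : L2R d, inner ℂ (tensor h' h) k = ∫ n, f n * inner ℂ h' (rep D l n h) ∂haar D

/-- The direct integral `∫^⊕_Σ L²(ℝᵈ) ⊗ L²(ℝᵈ) dμ(λ)` (of a constant field of Hilbert spaces). -/
abbrev DirectIntegral : Type _ := Lp (HS d) 2 D.plancherelMeasure

/-- The graph of the Fourier transform on `L¹(N) ∩ L²(N)`. -/
def fourierGraph : Set (L2N D × DirectIntegral D) :=
  {x | Integrable x.1 (haar D) ∧ ∀ᵐ l ∂D.plancherelMeasure, IsFourierAt D x.1 l (x.2 l)}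

/-- The graph of the Plancherel transform: the closed subspace generated by the graph of the
Fourier transform on `L¹(N) ∩ L²(N)`. -/
def plancherelGraph : Submodule ℂ (L2N D × DirectIntegral D) :=
  (Submodule.span ℂ (fourierGraph D)).topologicalClosure

/-- `φ̂ = Φ`: the field `Φ` is the Plancherel transform of `φ`. -/
def IsPlancherelTransform (φ : L2N D) (Φ : DirectIntegral D) : Prop :=
  (φ, Φ) ∈ plancherelGraph D

/-- The subspace `F = ∫^⊕_I L²(ℝᵈ) ⊗ u dμ(λ)` of the direct integral over `Σ`. -/
def fieldSpace (I : Set (Fin p → ℝ)) (u : L2R d) : Submodule ℂ (DirectIntegral D) where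
  carrier := {Φ | ∀ᵐ l ∂D.plancherelMeasure,
    (l ∈ I → Φ l ∈ tensorRange u) ∧ (l ∉ I → Φ l = 0)}
  zero_mem' := by
    filter_upwards [Lp.coeFn_zero (HS d) 2 D.plancherelMeasure] with l hl
    rw [hl]
    exact ⟨fun _ => Submodule.zero_mem _, fun _ => rfl⟩
  add_mem' := by
    intro Φ Ψ hΦ hΨ
    filter_upwards [hΦ, hΨ, Lp.coeFn_add Φ Ψ] with l h1 h2 hl
    rw [hl]
    exact ⟨fun h => Submodule.add_mem _ (h1.1 h) (h2.1 h), fun h => by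
      simp [h1.2 h, h2.2 h]⟩
  smul_mem' := by
    intro c Φ hΦ
    filter_upwards [hΦ, Lp.coeFn_smul c Φ] with l h1 hl
    rw [hl]
    exact ⟨fun h => Submodule.smul_mem _ _ (h1.1 h), fun h => by simp [h1.2 h]⟩

/-- The multiplicity-free band-limited space `H = P⁻¹(F)`, that is, the space of all `φ ∈ L²(N)`
whose Plancherel transform lies in `F = ∫^⊕_I L²(ℝᵈ) ⊗ u dμ(λ)`. -/
def bandSpace (I : Set (Fin p → ℝ)) (u : L2R d) : Submodule ℂ (L2N D) :=
  (plancherelGraph D ⊓ (fieldSpace D I u).comap (LinearMap.snd ℂ _ _)).map (LinearMap.fst ℂ _ _)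

/-- The quasi-lattice `Γ_{a,q,b}` of all products
`∏ exp((m_j/a_j) Z_j) ∏ exp((k_j/q_j) Y_j) ∏ exp((n_j/b_j) X_j)` with integers `m_j, k_j, n_j`. -/
def quasiLattice (a : Fin p → ℝ) (q b : Fin d → ℝ) : Set (ExpGroup D) :=
  {γ | ∃ (m : Fin p → ℤ) (k n : Fin d → ℤ),
    γ = (List.ofFn fun j => (exp ((m j / a j : ℝ) • D.Z j) : ExpGroup D)).prod *
      (List.ofFn fun j => (exp ((k j / q j : ℝ) • D.Y j) : ExpGroup D)).prod *
      (List.ofFn fun j => (exp ((n j / b j : ℝ) • D.X j) : ExpGroup D)).prod}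

/-- `s = sup_{λ ∈ I} |det B(λ)|` (used for nonempty bounded `I`, where the set is bounded). -/
def sSupDet (I : Set (Fin p → ℝ)) : ℝ := sSup ((fun l => |(D.B l).det|) '' I)

/-- The vector `b(s) = (s^{1/d}, …, s^{1/d})`. -/
def bVec (I : Set (Fin p → ℝ)) : Fin d → ℝ := fun _ => sSupDet D I ^ (1 / d : ℝ)

end ExpGroup

/-- The diagonal matrix with entries `1 / v_i`, denoted `D(q)` for `v = q` and `A(b)` for
`v = b`. -/
def invDiag {d : ℕ} (v : Fin d → ℝ) : Matrix (Fin d) (Fin d) ℝ :=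
  Matrix.diagonal fun i => 1 / v i

end BandLimited

end

noncomputable section

namespace BandLimited

/-! ### Square norms and sums in `ℝ≥0∞` -/

/-! On the Plancherel side, a vector `v` of the band-limited space is a field `f(λ) ⊗ u` on `I`. The
transform is isometric and turns `L(γ)` into left multiplication by `π_λ(γ)`. For the lattice point
with integer coordinates `(m, k, n)`, `π_λ(γ)` is the character `e^{2πi∑ m_j λ_j / a_j}` times the
Gabor shift with parameters `B(λ)D(q)k` and `A(b)n`. Hence, for fixed `(k, n)`, the coefficients
`⟨v, L(γ)η⟩` are Fourier coefficients in `λ` of one function supported in the box `∏[0, a_j]`.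
Parseval on this box sums over `m` and yields the factor `∏ a_j`. The Gabor frame at each `λ` then
sums over `(k, n)`. The normalization of `η̂` cancels `∏ a_j` and one of the two factors `|det
B(λ)|`, and the other is the Plancherel density, so the total is `‖v‖²`. This is
`tsum_enorm_sq_inner_repField`.

For the second claim, the norm of a Gabor Parseval window is forced by its lattice: `‖g‖² = |det A|
|det B|` (`IsParsevalFrame.enorm_sq_gabor`). Thus `‖η̂(λ)‖` is constant on `I`, and the condition on
`μ(I)` says `‖η‖ = 1`. A Parseval frame of unit vectors is orthonormal, and it is complete because
the space is closed.

The analytic input is that the Plancherel transform is isometric and covariant; surjectivity is not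
needed, since the space is defined as a preimage. The kernel of `f̂(λ)` at `(t, s)` is the Euclidean
Fourier transform of `f` in `(z, y)`, evaluated at `(λ, B(λ)ᵀt)` with `x = t - s`. The Jacobian of
`t ↦ B(λ)ᵀt` cancels the Plancherel density, and Euclidean Plancherel finishes
(`enorm_eq_of_mem_fourierGraph`). -/

theorem enorm_sq_eq_ofReal {E : Type*} [SeminormedAddCommGroup E] (x : E) :
    ‖x‖ₑ ^ 2 = ENNReal.ofReal (‖x‖ ^ 2) := by
  rw [ENNReal.ofReal_pow (norm_nonneg _), ofReal_norm]

/-- Parseval identities are moved to `ℝ≥0∞`, where sums and integrals interchange without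
summability conditions. -/
theorem hasSum_norm_sq_iff {ι E : Type*} [SeminormedAddCommGroup E] {f : ι → E} {s : ℝ}
    (hs : 0 ≤ s) :
    HasSum (fun i => ‖f i‖ ^ 2) s ↔ ∑' i, ‖f i‖ₑ ^ 2 = ENNReal.ofReal s := by
  simp_rw [enorm_sq_eq_ofReal]
  constructor
  · intro h
    rw [← ENNReal.ofReal_tsum_of_nonneg (fun i => by positivity) h.summable, h.tsum_eq]
  · intro h
    have hsum : Summable fun i => ‖f i‖ ^ 2 := by
      have := ENNReal.summable_toReal (f := fun i => ENNReal.ofReal (‖f i‖ ^ 2))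
        (by rw [h]; exact ENNReal.ofReal_ne_top)
      refine this.congr fun i => ?_
      rw [ENNReal.toReal_ofReal (by positivity)]
    have h2 := hsum.hasSum
    rw [← ENNReal.ofReal_tsum_of_nonneg (fun i => by positivity) hsum,
      ENNReal.ofReal_eq_ofReal_iff (tsum_nonneg fun i => by positivity) hs] at h
    rwa [h] at h2

theorem lintegral_enorm_sq_eq_eLpNorm_sq {α E : Type*} [MeasurableSpace α]
    [SeminormedAddCommGroup E] (μ : Measure α) (f : α → E) :
    ∫⁻ x, ‖f x‖ₑ ^ 2 ∂μ = eLpNorm f 2 μ ^ 2 := by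
  rw [eLpNorm_eq_lintegral_rpow_enorm_toReal (by simp) (by simp)]
  rw [← ENNReal.rpow_natCast, ← ENNReal.rpow_mul]
  simp

theorem lintegral_enorm_sq_Lp {α E : Type*} [MeasurableSpace α] {μ : Measure α}
    [NormedAddCommGroup E] (f : Lp E 2 μ) : ∫⁻ x, ‖f x‖ₑ ^ 2 ∂μ = ‖f‖ₑ ^ 2 := by
  rw [lintegral_enorm_sq_eq_eLpNorm_sq, Lp.enorm_def]

theorem memLp_two_of_lintegral_ne_top {α E : Type*} [MeasurableSpace α] {μ : Measure α}
    [NormedAddCommGroup E] {f : α → E} (hf : AEStronglyMeasurable f μ)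
    (h : ∫⁻ x, ‖f x‖ₑ ^ 2 ∂μ ≠ ∞) : MemLp f 2 μ := by
  refine ⟨hf, ?_⟩
  rw [lintegral_enorm_sq_eq_eLpNorm_sq] at h
  refine lt_top_iff_ne_top.2 fun h' => h ?_
  simp [h']

theorem MemLp.lintegral_enorm_sq_ne_top {α E : Type*} [MeasurableSpace α] {μ : Measure α}
    [NormedAddCommGroup E] {f : α → E} (hf : MemLp f 2 μ) :
    ∫⁻ x, ‖f x‖ₑ ^ 2 ∂μ ≠ ∞ := by
  rw [lintegral_enorm_sq_eq_eLpNorm_sq]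
  exact ENNReal.pow_ne_top hf.2.ne

/-! ### Parseval frames of unit vectors -/

/-- In the Parseval identity for `f i`, the term of index `i` already exhausts `‖f i‖² = 1`, so
every other term vanishes. -/
theorem IsParsevalFrame.orthonormal {ι E : Type*} [NormedAddCommGroup E] [InnerProductSpace ℂ E]
    {f : ι → E} {K : Submodule ℂ E} (h : IsParsevalFrame f K) (h1 : ∀ i, ‖f i‖ = 1) :
    Orthonormal ℂ f := by
  classical
  refine ⟨h1, fun i j hij => ?_⟩
  have hs := h.2 (f i) (h.1 i)
  have h2 : ∑ k ∈ ({i, j} : Finset ι), ‖inner ℂ (f i) (f k)‖ ^ 2 ≤ ‖f i‖ ^ 2 :=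
    sum_le_hasSum _ (fun k _ => by positivity) hs
  rw [Finset.sum_pair hij, inner_self_eq_norm_sq_to_K, h1] at h2
  norm_num at h2
  exact h2

/-- The component of `v` orthogonal to the closed span still lies in `K`, since `K` is closed, and
has only zero coefficients; the Parseval identity makes it zero. -/
theorem IsParsevalFrame.isONB {ι E : Type*} [NormedAddCommGroup E] [InnerProductSpace ℂ E]
    [CompleteSpace E] {f : ι → E} {K : Submodule ℂ E} (h : IsParsevalFrame f K)
    (h1 : ∀ i, ‖f i‖ = 1) (hK : IsClosed (K : Set E)) : IsONB f K := by
  refine ⟨h.orthonormal h1, le_antisymm ?_ fun v hv => ?_⟩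
  · refine Submodule.topologicalClosure_minimal _ (Submodule.span_le.2 ?_) hK
    rintro _ ⟨i, rfl⟩
    exact h.1 i
  · set W := (Submodule.span ℂ (Set.range f)).topologicalClosure with hW
    have hWK : W ≤ K := by
      refine Submodule.topologicalClosure_minimal _ (Submodule.span_le.2 ?_) hK
      rintro _ ⟨i, rfl⟩
      exact h.1 i
    have : CompleteSpace W :=
      (Submodule.isClosed_topologicalClosure _).completeSpace_coe
    have hw : W.starProjection v ∈ W := Submodule.starProjection_apply_mem W v
    have ho : v - W.starProjection v ∈ Wᗮ := Submodule.sub_starProjection_mem_orthogonal v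
    have hs := h.2 _ (K.sub_mem hv (hWK hw))
    have hz : ∀ i, ‖inner ℂ (v - W.starProjection v) (f i)‖ ^ 2 = 0 := fun i => by
      have := (Submodule.mem_orthogonal' _ _).1 ho (f i)
        (Submodule.le_topologicalClosure _ (Submodule.subset_span ⟨i, rfl⟩))
      simp [this]
    simp_rw [hz] at hs
    have h0 := hs.unique hasSum_zero
    have : v - W.starProjection v = 0 := by simpa using h0
    rw [sub_eq_zero.1 this]
    exact hw

/-! ### Fourier series -/

/-- The character `x ↦ e^{2πix}`. -/
def expi (x : ℝ) : ℂ := Complex.exp (((2 * Real.pi * x : ℝ) : ℂ) * Complex.I)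

theorem norm_expi (x : ℝ) : ‖expi x‖ = 1 := Complex.norm_exp_ofReal_mul_I _

theorem enorm_expi (x : ℝ) : ‖expi x‖ₑ = 1 := by
  rw [← ofReal_norm, norm_expi, ENNReal.ofReal_one]

@[fun_prop]
theorem continuous_expi : Continuous expi := by
  unfold expi
  fun_prop

theorem expi_add (x y : ℝ) : expi (x + y) = expi x * expi y := by
  rw [expi, expi, expi, ← Complex.exp_add]
  push_cast
  ring_nf

theorem expi_zero : expi 0 = 1 := by simp [expi]

/-- The half-open unit cube with corner `c`. -/
def unitCube {d : ℕ} (c : Fin d → ℝ) : Set (Fin d → ℝ) := {x | ∀ i, x i ∈ Set.Ioc (c i) (c i + 1)}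

theorem measurableSet_unitCube {d : ℕ} (c : Fin d → ℝ) : MeasurableSet (unitCube c) :=
  MeasurableSet.univ_pi' fun _ => measurableSet_Ioc

theorem volume_unitCube {d : ℕ} (c : Fin d → ℝ) : volume (unitCube c) = 1 := by
  have : unitCube c = Set.univ.pi fun i => Set.Ioc (c i) (c i + 1) := by
    ext x; simp [unitCube]
  rw [this, Real.volume_pi_Ioc]
  simp

theorem mFourier_coe {d : ℕ} (n : Fin d → ℤ) (x : Fin d → ℝ) :
    UnitAddTorus.mFourier n (fun i => (x i : UnitAddCircle)) =
      expi ((fun i => (n i : ℝ)) ⬝ᵥ x) := by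
  simp only [UnitAddTorus.mFourier, ContinuousMap.coe_mk, fourier_coe_apply, expi, dotProduct]
  rw [← Complex.exp_sum]
  congr 1
  push_cast
  rw [Finset.mul_sum, Finset.sum_mul]
  refine Finset.sum_congr rfl fun i _ => ?_
  ring

theorem tsum_enorm_sq_setIntegral_unitCube {d : ℕ} (c : Fin d → ℝ) {h : (Fin d → ℝ) → ℂ}
    (hh : MemLp h 2 (volume.restrict (unitCube c))) :
    ∑' k : Fin d → ℤ, ‖∫ t in unitCube c, expi ((fun i => (k i : ℝ)) ⬝ᵥ t) * h t‖ₑ ^ 2 =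
      ∫⁻ t in unitCube c, ‖h t‖ₑ ^ 2 := by
  -- The circle carries its Haar measure of mass one, so the identification of the torus with the
  -- unit cube preserves measure.
  let _ : MeasureSpace UnitAddCircle := ⟨AddCircle.haarAddCircle⟩
  let S : UnitAddTorus (Fin d) → (Fin d → ℝ) :=
    fun x => (UnitAddTorus.measurableEquivPiIoc c x : Fin d → ℝ)
  have hS : MeasurePreserving S volume (volume.restrict (unitCube c)) :=
    (measurePreserving_subtype_coe (measurableSet_unitCube c)).comp
      (UnitAddTorus.measurePreserving_equivPiIoc c)
  have hSmk : ∀ x ∈ unitCube c, S (fun i => (x i : UnitAddCircle)) = x := fun x hx => by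
    have := (UnitAddTorus.measurableEquivPiIoc c).apply_symm_apply ⟨x, hx⟩
    exact congrArg Subtype.val this
  have hf : MemLp (fun x => h (S x)) 2 volume := hh.comp_measurePreserving hS
  have key := UnitAddTorus.hasSum_sq_mFourierCoeff hf.toLp
  have e1 : ∀ n, UnitAddTorus.mFourierCoeff hf.toLp n =
      ∫ t in unitCube c, expi ((fun i => ((-n) i : ℝ)) ⬝ᵥ t) * h t := fun n => by
    have : UnitAddTorus.mFourierCoeff hf.toLp n =
        UnitAddTorus.mFourierCoeff (fun x => h (S x)) n := by
      refine integral_congr_ae ?_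
      filter_upwards [hf.coeFn_toLp] with x hx
      rw [hx]
    rw [this, UnitAddTorus.mFourierCoeff_eq_integral _ _ c]
    refine setIntegral_congr_fun (measurableSet_unitCube c) fun x hx => ?_
    simp only [hSmk x hx, mFourier_coe, smul_eq_mul]
  rw [hasSum_norm_sq_iff (integral_nonneg fun _ => by positivity)] at key
  have e2 : ENNReal.ofReal (∫ t, ‖hf.toLp _ t‖ ^ 2) = ∫⁻ t in unitCube c, ‖h t‖ₑ ^ 2 := by
    rw [ofReal_integral_eq_lintegral_ofReal]
    · simp_rw [← enorm_sq_eq_ofReal]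
      rw [lintegral_enorm_sq_Lp, Lp.enorm_toLp, lintegral_enorm_sq_eq_eLpNorm_sq]
      congr 1
      exact eLpNorm_comp_measurePreserving hh.1 hS
    · exact (memLp_two_iff_integrable_sq_norm (Lp.aestronglyMeasurable _)).1 (Lp.memLp _)
    · exact Filter.Eventually.of_forall fun _ => by positivity
  rw [← e2, ← key]
  simp_rw [e1]
  -- Fourier coefficients on the torus use the character of index `-k`; the sum is reindexed by
  -- negation.
  rw [← (Equiv.neg (Fin d → ℤ)).tsum_eq]
  simp

theorem lintegral_comp_mulVec {d : ℕ} {M : Matrix (Fin d) (Fin d) ℝ} (hM : M.det ≠ 0)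
    {f : (Fin d → ℝ) → ℝ≥0∞} (hf : AEMeasurable f) :
    ∫⁻ t, f (M *ᵥ t) = ENNReal.ofReal |M.det|⁻¹ * ∫⁻ t, f t := by
  have h := Real.map_matrix_volume_pi_eq_smul_volume_pi hM
  have hm : Measurable (Matrix.toLin' M) :=
    (Matrix.toLin' M).continuous_of_finiteDimensional.measurable
  have e : ∫⁻ t, f (M *ᵥ t) = ∫⁻ t, f t ∂(Measure.map (Matrix.toLin' M) volume) := by
    rw [lintegral_map' _ hm.aemeasurable]
    · simp
    · rw [h]
      exact hf.smul_measure _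
  rw [e, h, lintegral_smul_measure, abs_inv, smul_eq_mul]

theorem integral_comp_mulVec {d : ℕ} {M : Matrix (Fin d) (Fin d) ℝ} (hM : M.det ≠ 0)
    {f : (Fin d → ℝ) → ℂ} (hf : AEStronglyMeasurable f volume) :
    ∫ t, f (M *ᵥ t) = ((|M.det|⁻¹ : ℝ) : ℂ) * ∫ t, f t := by
  have h := Real.map_matrix_volume_pi_eq_smul_volume_pi hM
  have hm : Measurable (Matrix.toLin' M) :=
    (Matrix.toLin' M).continuous_of_finiteDimensional.measurable
  have e : ∫ t, f (M *ᵥ t) = ∫ t, f t ∂(Measure.map (Matrix.toLin' M) volume) := by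
    rw [integral_map hm.aemeasurable]
    · simp
    · rw [h]
      exact hf.smul_measure _
  rw [e, h, integral_smul_measure, ENNReal.toReal_ofReal (abs_nonneg _), abs_inv]
  simp

theorem quasiMeasurePreserving_mulVec {d : ℕ} {M : Matrix (Fin d) (Fin d) ℝ} (hM : M.det ≠ 0) :
    Measure.QuasiMeasurePreserving (fun t : Fin d → ℝ => M *ᵥ t) := by
  refine ⟨(Matrix.toLin' M).continuous_of_finiteDimensional.measurable, ?_⟩
  have h := Real.map_matrix_volume_pi_eq_smul_volume_pi hM
  change Measure.map (Matrix.toLin' M) volume ≪ volume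
  rw [h]
  exact Measure.smul_absolutelyContinuous

/-- Parseval's identity for the Fourier series of a function supported in a parallelepiped
`M⁻¹(c + (0, 1]ᵈ)`. -/
theorem tsum_enorm_sq_integral_expi {d : ℕ} {M : Matrix (Fin d) (Fin d) ℝ} (hM : M.det ≠ 0)
    (c : Fin d → ℝ) {h : (Fin d → ℝ) → ℂ} (hh : MemLp h 2)
    (hc : ∀ᵐ t, M *ᵥ t ∉ unitCube c → h t = 0) :
    ∑' k : Fin d → ℤ, ‖∫ t, expi ((fun i => (k i : ℝ)) ⬝ᵥ (M *ᵥ t)) * h t‖ₑ ^ 2 =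
      ENNReal.ofReal |M.det|⁻¹ * ∫⁻ t, ‖h t‖ₑ ^ 2 := by
  have hdet : IsUnit M.det := isUnit_iff_ne_zero.2 hM
  have hM' : (M⁻¹).det ≠ 0 := by
    rw [Matrix.det_nonsing_inv]; simpa using hM
  set h' : (Fin d → ℝ) → ℂ := fun s => h (M⁻¹ *ᵥ s) with hh'
  have hcancel : ∀ t, M⁻¹ *ᵥ (M *ᵥ t) = t := fun t => by
    rw [Matrix.mulVec_mulVec, Matrix.nonsing_inv_mul _ hdet, Matrix.one_mulVec]
  have hcancel' : ∀ t, M *ᵥ (M⁻¹ *ᵥ t) = t := fun t => by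
    rw [Matrix.mulVec_mulVec, Matrix.mul_nonsing_inv _ hdet, Matrix.one_mulVec]
  have hm' : AEStronglyMeasurable h' volume :=
    hh.1.comp_quasiMeasurePreserving (quasiMeasurePreserving_mulVec hM')
  have hl : ∫⁻ t, ‖h t‖ₑ ^ 2 = ENNReal.ofReal |M.det|⁻¹ * ∫⁻ s, ‖h' s‖ₑ ^ 2 := by
    rw [← lintegral_comp_mulVec hM (hm'.enorm.pow_const 2)]
    simp [hh', hcancel]
  have hpos : 0 < |M.det| := abs_pos.2 hM
  have hmem : MemLp h' 2 := by
    refine memLp_two_of_lintegral_ne_top hm' fun htop => ?_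
    rw [htop, ENNReal.mul_top (by simpa using hM)] at hl
    exact MemLp.lintegral_enorm_sq_ne_top hh hl
  have hsupp : ∀ᵐ s, s ∉ unitCube c → h' s = 0 := by
    filter_upwards [(quasiMeasurePreserving_mulVec hM').ae hc] with s hs hsc
    rw [hcancel'] at hs
    exact hs hsc
  have hi : ∀ k : Fin d → ℤ, ∫ t, expi ((fun i => (k i : ℝ)) ⬝ᵥ (M *ᵥ t)) * h t =
      ((|M.det|⁻¹ : ℝ) : ℂ) * ∫ t in unitCube c, expi ((fun i => (k i : ℝ)) ⬝ᵥ t) * h' t := by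
    intro k
    rw [setIntegral_eq_integral_of_ae_compl_eq_zero, ← integral_comp_mulVec hM]
    · simp [hh', hcancel]
    · refine Continuous.aestronglyMeasurable ?_ |>.mul hm'
      unfold dotProduct
      fun_prop
    · filter_upwards [hsupp] with s hs hsc
      rw [hs hsc, mul_zero]
  simp_rw [hi, enorm_mul, mul_pow]
  rw [ENNReal.tsum_mul_left, tsum_enorm_sq_setIntegral_unitCube c (hmem.restrict _), hl, ← mul_assoc]
  have e1 : ‖((|M.det|⁻¹ : ℝ) : ℂ)‖ₑ = ENNReal.ofReal |M.det|⁻¹ := by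
    rw [← ofReal_norm, Complex.norm_real, Real.norm_of_nonneg (by positivity)]
  -- The substitution gives each coefficient a factor `|det M|⁻¹`, hence its square in the sum; one
  -- of the two is absorbed in passing from `∫ |h'|²` to `∫ |h|²`.
  rw [e1, pow_two]
  congr 1
  rw [← lintegral_indicator (measurableSet_unitCube c)]
  refine lintegral_congr_ae ?_
  filter_upwards [hsupp] with s hs
  by_cases hsc : s ∈ unitCube c
  · simp [hsc]
  · simp [hsc, hs hsc]

/-! ### Plancherel's theorem for integrable square integrable functions -/

open FourierTransform SchwartzMap in
-- The Fourier transform on `L²` is isometric, so it suffices that it agrees almost everywhere with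
-- the integral formula. Both have the same pairings with smooth compactly supported functions: the
-- first as a tempered distribution, the second by Fubini.
theorem lintegral_enorm_sq_fourier {V : Type*} [NormedAddCommGroup V] [InnerProductSpace ℝ V]
    [FiniteDimensional ℝ V] [MeasurableSpace V] [BorelSpace V] {f : V → ℂ}
    (hf : Integrable f) (hf2 : MemLp f 2) :
    ∫⁻ w, ‖𝓕 f w‖ₑ ^ 2 = ∫⁻ v, ‖f v‖ₑ ^ 2 := by
  set F : Lp ℂ 2 (volume : Measure V) := hf2.toLp with hF
  have hcont : Continuous (𝓕 f) :=
    VectorFourier.fourierIntegral_continuous Real.continuous_fourierChar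
      (by exact continuous_inner) hf
  have key : ∀ᵐ w, (𝓕 F : Lp ℂ 2 (volume : Measure V)) w = 𝓕 f w := by
    refine ae_eq_of_integral_contDiff_smul_eq ((Lp.memLp _).locallyIntegrable (by norm_num))
      hcont.locallyIntegrable fun g hg hgs => ?_
    have hgs' : HasCompactSupport (fun x => (g x : ℂ)) :=
      hgs.comp_left (g := fun x : ℝ => (x : ℂ)) (by simp)
    have hg' : ContDiff ℝ ((⊤ : ℕ∞) : WithTop ℕ∞) (fun x => (g x : ℂ)) :=
      Complex.ofRealCLM.contDiff.comp hg
    set G : 𝓢(V, ℂ) := hgs'.toSchwartzMap hg' with hG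
    have h1 := congrArg (fun T => T G) (Lp.fourier_toTemperedDistribution_eq F)
    simp only [TemperedDistribution.fourier_apply, Lp.toTemperedDistribution_apply] at h1
    have h2 := VectorFourier.integral_fourierIntegral_smul_eq_flip (μ := (volume : Measure V))
      (ν := (volume : Measure V)) (f := G) (g := f)
      (L := innerₗ V) Real.continuous_fourierChar (by exact continuous_inner) G.integrable hf
    rw [flip_innerₗ] at h2
    have h3 : ∫ x, (𝓕 G) x • F x = ∫ x, (𝓕 (G : V → ℂ)) x • f x := by
      refine integral_congr_ae ?_
      filter_upwards [hf2.coeFn_toLp] with x hx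
      rw [hF, hx, SchwartzMap.fourier_coe]
    have h4 := h1.symm.trans (h3.trans h2)
    exact h4
  have e1 : ∫⁻ w, ‖𝓕 f w‖ₑ ^ 2 = ‖(𝓕 F : Lp ℂ 2 (volume : Measure V))‖ₑ ^ 2 := by
    rw [← lintegral_enorm_sq_Lp]
    refine lintegral_congr_ae ?_
    filter_upwards [key] with w hw
    rw [hw]
  rw [e1, ← ofReal_norm, Lp.norm_fourier_eq, ofReal_norm, hF, Lp.enorm_toLp,
    lintegral_enorm_sq_eq_eLpNorm_sq]

theorem lintegral_enorm_sq_integral_expi_pi {ι : Type*} [Fintype ι] {f : (ι → ℝ) → ℂ}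
    (hf : Integrable f) (hf2 : MemLp f 2) :
    ∫⁻ w : ι → ℝ, ‖∫ v, expi (w ⬝ᵥ v) * f v‖ₑ ^ 2 = ∫⁻ v, ‖f v‖ₑ ^ 2 := by
  have hp := PiLp.volume_preserving_ofLp ι
  have hp' := PiLp.volume_preserving_toLp ι
  have he := (MeasurableEquiv.toLp 2 (ι → ℝ)).symm.measurableEmbedding
  have h := lintegral_enorm_sq_fourier (V := EuclideanSpace ℝ ι) (f := fun v => f v.ofLp)
    (hp.integrable_comp_of_integrable hf) (hf2.comp_measurePreserving hp)
  have e1 := hp.lintegral_comp_emb he (fun v => ‖f v‖ₑ ^ 2)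
  rw [e1] at h
  -- The reflection `w ↦ -w` reconciles `e^{2πi⟨w, v⟩}` with the opposite sign in the definition of
  -- `𝓕`.
  rw [← h, ← lintegral_neg_eq_self,
    ← hp.lintegral_comp_emb he (fun w => ‖∫ v, expi ((-w) ⬝ᵥ v) * f v‖ₑ ^ 2)]
  refine lintegral_congr fun w => ?_
  rw [Real.fourier_eq', ← hp.integral_comp he]
  congr 3
  ext v
  simp [expi, PiLp.inner_apply, dotProduct, smul_eq_mul]

theorem lintegral_enorm_sq_integral_expi_prod {p d : ℕ} {f : (Fin p → ℝ) × (Fin d → ℝ) → ℂ}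
    (hf : Integrable f) (hf2 : MemLp f 2) :
    ∫⁻ w : (Fin p → ℝ) × (Fin d → ℝ), ‖∫ v, expi (w.1 ⬝ᵥ v.1 + w.2 ⬝ᵥ v.2) * f v‖ₑ ^ 2 =
      ∫⁻ v, ‖f v‖ₑ ^ 2 := by
  have hp := volume_measurePreserving_sumPiEquivProdPi (fun _ : Fin p ⊕ Fin d => ℝ)
  have he := (MeasurableEquiv.sumPiEquivProdPi (fun _ : Fin p ⊕ Fin d => ℝ)).measurableEmbedding
  have h := lintegral_enorm_sq_integral_expi_pi
    (f := fun v => f (MeasurableEquiv.sumPiEquivProdPi (fun _ : Fin p ⊕ Fin d => ℝ) v))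
    (hp.integrable_comp_of_integrable hf) (hf2.comp_measurePreserving hp)
  rw [hp.lintegral_comp_emb he (fun v => ‖f v‖ₑ ^ 2)] at h
  rw [← h, ← hp.lintegral_comp_emb he]
  refine lintegral_congr fun w => ?_
  rw [← hp.integral_comp he]
  congr 3
  ext v
  simp [dotProduct, MeasurableEquiv.sumPiEquivProdPi, Equiv.sumPiEquivProdPi]

/-! ### The matrix `B(λ)` and the cross-section -/

namespace NilpotentAlgebra

variable {p d : ℕ} {𝔫 : Type*} [LieRing 𝔫] [LieAlgebra ℝ 𝔫] (D : NilpotentAlgebra p d 𝔫)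

theorem B_add (l m : Fin p → ℝ) : D.B (l + m) = D.B l + D.B m := by
  ext i j
  simp [B, functional, add_mul, Finset.sum_add_distrib]
  ring

theorem B_smul (c : ℝ) (l : Fin p → ℝ) : D.B (c • l) = c • D.B l := by
  ext i j
  simp [B, functional, Finset.mul_sum, mul_assoc]

@[fun_prop]
theorem continuous_B : Continuous D.B := by
  refine continuous_matrix fun i j => ?_
  simp only [B, functional, Matrix.of_apply, LinearMap.sum_apply, LinearMap.smul_apply]
  fun_prop

@[fun_prop]
theorem continuous_det_B : Continuous fun l => (D.B l).det := D.continuous_B.matrix_det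

theorem measurableSet_crossSection : MeasurableSet D.crossSection :=
  (isOpen_ne_fun D.continuous_det_B continuous_const).measurableSet

/-- A nonempty cross-section has full Lebesgue measure. -/
theorem ae_mem_crossSection (h : D.crossSection.Nonempty) : ∀ᵐ l, l ∈ D.crossSection := by
  obtain ⟨l₀, hl₀⟩ := h
  -- By Fubini in the direction `l₀`, it is enough to look at each line `l + t l₀`. There `det B` is
  -- the polynomial `det(t B(l₀) + B(l))` in `t`, whose coefficient of degree `d` is `det B(l₀) ≠
  -- 0`, so it has finitely many zeros.
  refine ae_mem_of_ae_add_linearMap_mem ((LinearMap.id : ℝ →ₗ[ℝ] ℝ).smulRight l₀) volume volume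
    D.measurableSet_crossSection fun l => ?_
  set P : Polynomial ℝ := ((Polynomial.X : Polynomial ℝ) • (D.B l₀).map Polynomial.C +
    (D.B l).map Polynomial.C).det with hP
  have heval : ∀ t, P.eval t = (D.B (t • l₀ + l)).det := fun t => by
    rw [hP, B_add, B_smul, ← Polynomial.coe_evalRingHom t, RingHom.map_det]
    congr 1
    ext i j
    simp
    ring
  have hP0 : P ≠ 0 := by
    intro h0
    have h1 := Polynomial.coeff_det_X_add_C_card (D.B l₀) (D.B l)
    rw [← hP, h0, Polynomial.coeff_zero] at h1
    exact hl₀ h1.symm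
  have hfin : {t : ℝ | P.IsRoot t}.Finite := Polynomial.finite_setOfPred_isRoot hP0
  rw [ae_iff]
  refine measure_mono_null (fun t ht => ?_) (hfin.measure_zero volume)
  simp only [crossSection, Set.mem_ofPred_eq, not_not] at ht ⊢
  rw [Polynomial.IsRoot, heval]
  simpa [add_comm] using ht

end NilpotentAlgebra

/-! ### The density of a Gabor Parseval frame -/

theorem mem_unitCube_intCast_iff {d : ℕ} (x : Fin d → ℝ) (c : Fin d → ℤ) :
    x ∈ unitCube (fun i => (c i : ℝ)) ↔ c = fun i => ⌈x i⌉ - 1 := by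
  simp only [unitCube, Set.mem_ofPred_eq, Set.mem_Ioc, funext_iff]
  refine forall_congr' fun i => ?_
  have := Int.ceil_eq_iff (z := c i + 1) (a := x i)
  push_cast at this
  rw [add_sub_cancel_right] at this
  rw [← this]
  omega

/-- The parallelepipeds `M⁻¹(c + (0, 1]ᵈ)`, `c ∈ ℤᵈ`, tile the space. -/
theorem tsum_setLIntegral_unitCube {d : ℕ} (M : Matrix (Fin d) (Fin d) ℝ)
    (μ : Measure (Fin d → ℝ)) (F : (Fin d → ℝ) → ℝ≥0∞) :
    ∑' c : Fin d → ℤ, ∫⁻ t in {t | M *ᵥ t ∈ unitCube fun i => (c i : ℝ)}, F t ∂μ =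
      ∫⁻ t, F t ∂μ := by
  rw [← lintegral_iUnion]
  · have : ⋃ c : Fin d → ℤ, {t | M *ᵥ t ∈ unitCube fun i => (c i : ℝ)} = Set.univ := by
      ext t
      simp [mem_unitCube_intCast_iff]
    rw [this, Measure.restrict_univ]
  · intro c
    exact (measurableSet_unitCube _).preimage
      (Matrix.toLin' M).continuous_of_finiteDimensional.measurable
  · intro c c' hcc'
    rw [Function.onFun, Set.disjoint_left]
    intro t ht ht'
    simp only [Set.mem_ofPred_eq, mem_unitCube_intCast_iff] at ht ht'
    exact hcc' (ht.trans ht'.symm)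

theorem coeFn_timeFreq {d : ℕ} (ω x : Fin d → ℝ) (F : L2R d) :
    timeFreq ω x F =ᵐ[volume] fun t => expi (t ⬝ᵥ ω) * F (t - x) :=
  MemLp.coeFn_toLp _

/-- An integrated form of `∑ₙ |g(t - An)|² = |det B|`. The frame identity is applied to the
indicator of `E`. For fixed `n` its coefficients are, as `k` varies, the Fourier coefficients of
`g(t - An)` on `E`, and `E` lies in one cell of the lattice dual to `Bℤᵈ`, so Parseval sums them. -/
theorem tsum_setLIntegral_translates_of_isParsevalFrame {d : ℕ} {g : L2R d}
    {A B : Matrix (Fin d) (Fin d) ℝ} (hB : B.det ≠ 0)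
    (h : IsParsevalFrame (gaborSystem g A B) ⊤) {E : Set (Fin d → ℝ)} (hE : MeasurableSet E)
    (hEfin : volume E ≠ ∞) (c : Fin d → ℝ) (hEc : ∀ t ∈ E, Bᵀ *ᵥ t ∈ unitCube c) :
    ∑' n : Fin d → ℤ, ENNReal.ofReal |B.det|⁻¹ *
      ∫⁻ t in E, ‖g (t - A *ᵥ fun j => (n j : ℝ))‖ₑ ^ 2 = volume E := by
  set f : L2R d := indicatorConstLp 2 hE hEfin (1 : ℂ) with hf
  have hs := (hasSum_norm_sq_iff (by positivity)).1 (h.2 f Submodule.mem_top)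
  rw [← enorm_sq_eq_ofReal, ← lintegral_enorm_sq_Lp] at hs
  have hv : ∫⁻ t, ‖f t‖ₑ ^ 2 = volume E := by
    rw [← lintegral_indicator_one hE]
    refine lintegral_congr_ae ?_
    filter_upwards [indicatorConstLp_coeFn (p := 2) (hs := hE) (hμs := hEfin) (c := (1 : ℂ))] with t ht
    rw [hf, ht]
    by_cases htE : t ∈ E <;> simp [htE]
  rw [hv, ENNReal.tsum_prod (f := fun k n => ‖inner ℂ f (gaborSystem g A B (k, n))‖ₑ ^ 2),
    ENNReal.tsum_comm] at hs
  rw [← hs]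
  refine tsum_congr fun n => ?_
  set x : Fin d → ℝ := A *ᵥ fun j => (n j : ℝ) with hx
  have hg : MemLp (fun t => g (t - x)) 2 volume :=
    (Lp.memLp g).comp_measurePreserving (measurePreserving_sub_right volume x)
  have key := tsum_enorm_sq_integral_expi (M := Bᵀ) (by rwa [Matrix.det_transpose]) c
    (hg.indicator hE) (Filter.Eventually.of_forall fun t ht =>
      Set.indicator_of_notMem (fun htE => ht (hEc t htE)) _)
  rw [Matrix.det_transpose] at key
  rw [← lintegral_indicator hE]
  have e1 : ∫⁻ t, ‖E.indicator (fun t => g (t - x)) t‖ₑ ^ 2 =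
      ∫⁻ t, E.indicator (fun t => ‖g (t - x)‖ₑ ^ 2) t := by
    refine lintegral_congr fun t => ?_
    by_cases htE : t ∈ E <;> simp [htE]
  rw [← e1, ← key]
  refine tsum_congr fun k => ?_
  congr 2
  rw [L2.inner_def]
  refine integral_congr_ae ?_
  filter_upwards [indicatorConstLp_coeFn (p := 2) (hs := hE) (hμs := hEfin) (c := (1 : ℂ)),
    coeFn_timeFreq (B *ᵥ fun j => (k j : ℝ)) x g] with t ht ht'
  simp only [gaborSystem]
  rw [hf, ht, ht', Matrix.mulVec_transpose, Matrix.dotProduct_mulVec, dotProduct_comm]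
  by_cases htE : t ∈ E <;> simp [htE]

/-- A fundamental domain `C` of `Aℤᵈ` is cut by the cells dual to `Bℤᵈ`, and the preceding identity
is summed over the pieces. One side gives `vol C = |det A|`. On the other the translates of `C` tile
the space, which leaves `|det B|⁻¹‖g‖²`. -/
theorem IsParsevalFrame.enorm_sq_gabor {d : ℕ} {g : L2R d}
    {A B : Matrix (Fin d) (Fin d) ℝ} (hA : A.det ≠ 0) (hB : B.det ≠ 0)
    (h : IsParsevalFrame (gaborSystem g A B) ⊤) :
    ‖g‖ₑ ^ 2 = ENNReal.ofReal (|A.det| * |B.det|) := by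
  have hA' : (A⁻¹).det ≠ 0 := by
    rw [Matrix.det_nonsing_inv]; simpa using hA
  have hu : IsUnit A.det := isUnit_iff_ne_zero.2 hA
  have hmeas : ∀ (M : Matrix (Fin d) (Fin d) ℝ) (c : Fin d → ℝ),
      MeasurableSet {t | M *ᵥ t ∈ unitCube c} := fun M c => (measurableSet_unitCube _).preimage
      (Matrix.toLin' M).continuous_of_finiteDimensional.measurable
  set C : Set (Fin d → ℝ) := {t | A⁻¹ *ᵥ t ∈ unitCube 0} with hC
  have hvC : volume C = ENNReal.ofReal |A.det| := by
    have := lintegral_comp_mulVec hA' (f := (unitCube 0).indicator 1)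
      (measurable_one.indicator (measurableSet_unitCube 0)).aemeasurable
    rw [lintegral_indicator_one (measurableSet_unitCube 0), volume_unitCube, mul_one,
      Matrix.det_nonsing_inv, Ring.inverse_eq_inv', abs_inv, inv_inv] at this
    rw [← this, ← lintegral_indicator_one (hmeas _ _)]
    rfl
  have h1 : ∑' c : Fin d → ℤ, ∑' n : Fin d → ℤ, ENNReal.ofReal |B.det|⁻¹ *
      ∫⁻ t in {t | Bᵀ *ᵥ t ∈ unitCube fun i => (c i : ℝ)} ∩ C,
        ‖g (t - A *ᵥ fun j => (n j : ℝ))‖ₑ ^ 2 = ENNReal.ofReal |A.det| := by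
    have : ∀ c : Fin d → ℤ, _ := fun c => tsum_setLIntegral_translates_of_isParsevalFrame hB h
      (E := {t | Bᵀ *ᵥ t ∈ unitCube fun i => (c i : ℝ)} ∩ C)
      ((hmeas _ _).inter (hmeas _ _))
      (ne_top_of_le_ne_top (by rw [hvC]; exact ENNReal.ofReal_ne_top)
        (measure_mono Set.inter_subset_right)) _ (fun t ht => ht.1)
    simp_rw [this]
    have h2 := tsum_setLIntegral_unitCube Bᵀ (volume.restrict C) 1
    simp only [Pi.one_apply, lintegral_one, Measure.restrict_apply_univ] at h2
    rw [← hvC, ← h2]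
    refine tsum_congr fun c => ?_
    rw [Measure.restrict_apply (hmeas _ _)]
  have h3 : ∀ n : Fin d → ℤ, ∑' c : Fin d → ℤ, ENNReal.ofReal |B.det|⁻¹ *
      ∫⁻ t in {t | Bᵀ *ᵥ t ∈ unitCube fun i => (c i : ℝ)} ∩ C,
        ‖g (t - A *ᵥ fun j => (n j : ℝ))‖ₑ ^ 2 = ENNReal.ofReal |B.det|⁻¹ *
        ∫⁻ t in {t | A⁻¹ *ᵥ t ∈ unitCube fun i => ((-n) i : ℝ)}, ‖g t‖ₑ ^ 2 := fun n => by
    rw [ENNReal.tsum_mul_left]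
    congr 1
    set x : Fin d → ℝ := A *ᵥ fun j => (n j : ℝ) with hx
    have h4 := tsum_setLIntegral_unitCube Bᵀ (volume.restrict C) fun t => ‖g (t - x)‖ₑ ^ 2
    simp_rw [Measure.restrict_restrict (hmeas _ _)] at h4
    -- Translating by `x = An` moves the integral over `C` to the tile of index `-n`.
    rw [h4, ← lintegral_indicator (hmeas _ _), ← lintegral_indicator (hmeas _ _),
      ← lintegral_add_right_eq_self _ x]
    refine lintegral_congr fun t => ?_
    have hmem : t + x ∈ C ↔ t ∈ {t | A⁻¹ *ᵥ t ∈ unitCube fun i => ((-n) i : ℝ)} := by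
      simp only [hC, Set.mem_ofPred_eq, Matrix.mulVec_add, hx, Matrix.mulVec_mulVec,
        Matrix.nonsing_inv_mul _ hu, Matrix.one_mulVec, unitCube, Set.mem_Ioc, Pi.add_apply,
        Pi.zero_apply, Pi.neg_apply, Int.cast_neg]
      refine forall_congr' fun i => ?_
      constructor <;> rintro ⟨h1, h2⟩ <;> constructor <;> linarith
    by_cases ht : t + x ∈ C
    · rw [Set.indicator_of_mem ht, Set.indicator_of_mem (hmem.1 ht), add_sub_cancel_right]
    · rw [Set.indicator_of_notMem ht, Set.indicator_of_notMem (fun h' => ht (hmem.2 h'))]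
  rw [ENNReal.tsum_comm] at h1
  simp_rw [h3] at h1
  have h5 := (Equiv.neg (Fin d → ℤ)).tsum_eq fun n =>
    ∫⁻ t in {t | A⁻¹ *ᵥ t ∈ unitCube fun i => (n i : ℝ)}, ‖g t‖ₑ ^ 2
  simp only [Equiv.neg_apply] at h5
  rw [ENNReal.tsum_mul_left, h5, tsum_setLIntegral_unitCube, lintegral_enorm_sq_Lp] at h1
  have hBpos : 0 < |B.det| := abs_pos.2 hB
  rw [mul_comm, ENNReal.ofReal_mul (abs_nonneg _), ← h1, ← mul_assoc,
    ← ENNReal.ofReal_mul (abs_nonneg _), mul_inv_cancel₀ hBpos.ne']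
  simp

/-! ### Multiplication by unimodular functions -/

section expMul

variable {α : Type*} [MeasurableSpace α] {μ : Measure α}

theorem memLp_expMul {θ : α → ℝ} (hθ : Measurable θ) (F : Lp ℂ 2 μ) :
    MemLp (fun a => expi (θ a) * F a) 2 μ := by
  refine (Lp.memLp F).congr_norm
    ((continuous_expi.measurable.comp hθ).aestronglyMeasurable.mul (Lp.aestronglyMeasurable F))
    (Filter.Eventually.of_forall fun a => ?_)
  rw [norm_mul, norm_expi, one_mul]

/-- Multiplication by `e^{2πiθ}`, as an isometry of `L²`. -/
def expMul (θ : α → ℝ) (hθ : Measurable θ) : Lp ℂ 2 μ →ₗᵢ[ℂ] Lp ℂ 2 μ where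
  toFun F := (memLp_expMul hθ F).toLp _
  map_add' F G := by
    rw [← MemLp.toLp_add]
    refine MemLp.toLp_congr _ _ ?_
    filter_upwards [Lp.coeFn_add F G] with a ha
    change expi (θ a) * (F + G : Lp ℂ 2 μ) a = expi (θ a) * F a + expi (θ a) * G a
    rw [ha, Pi.add_apply, mul_add]
  map_smul' c F := by
    rw [RingHom.id_apply, ← MemLp.toLp_const_smul]
    refine MemLp.toLp_congr _ _ ?_
    filter_upwards [Lp.coeFn_smul c F] with a ha
    simp [ha]
    ring
  norm_map' F := by
    change ‖(memLp_expMul hθ F).toLp _‖ = _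
    rw [Lp.norm_toLp, Lp.norm_def]
    congr 1
    refine eLpNorm_congr_norm_ae (Filter.Eventually.of_forall fun a => ?_)
    rw [norm_mul, norm_expi, one_mul]

theorem coeFn_expMul {θ : α → ℝ} (hθ : Measurable θ) (F : Lp ℂ 2 μ) :
    expMul θ hθ F =ᵐ[μ] fun a => expi (θ a) * F a :=
  MemLp.coeFn_toLp (memLp_expMul hθ F)

/-- Dominated convergence: two unimodular numbers differ by at most `2`, so the squared integrand is
at most `4|F|²`. -/
theorem continuous_expMul_apply {Λ : Type*} [TopologicalSpace Λ] [FirstCountableTopology Λ]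
    {θ : Λ → α → ℝ} (hθ : ∀ l, Measurable (θ l)) (hc : ∀ a, Continuous fun l => θ l a)
    (F : Lp ℂ 2 μ) : Continuous fun l => expMul (θ l) (hθ l) F := by
  rw [continuous_iff_continuousAt]
  intro l₀
  rw [ContinuousAt, tendsto_iff_edist_tendsto_0]
  have hF : Measurable fun a => F a := (Lp.stronglyMeasurable F).measurable
  have h1 : ∀ l, edist (expMul (θ l) (hθ l) F) (expMul (θ l₀) (hθ l₀) F) ^ 2 =
      ∫⁻ a, ‖(expi (θ l a) - expi (θ l₀ a)) * F a‖ₑ ^ 2 ∂μ := fun l => by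
    rw [edist_eq_enorm_sub, ← lintegral_enorm_sq_Lp]
    refine lintegral_congr_ae ?_
    filter_upwards [coeFn_expMul (hθ l) F, coeFn_expMul (hθ l₀) F,
      Lp.coeFn_sub (expMul (θ l) (hθ l) F) (expMul (θ l₀) (hθ l₀) F)] with a h1 h2 h3
    rw [h3, Pi.sub_apply, h1, h2, sub_mul]
  have h2 : Filter.Tendsto
      (fun l => ∫⁻ a, ‖(expi (θ l a) - expi (θ l₀ a)) * F a‖ₑ ^ 2 ∂μ) (nhds l₀) (nhds 0) := by
    have h0 : ∫⁻ _ : α, (0 : ℝ≥0∞) ∂μ = 0 := lintegral_zero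
    rw [← h0]
    refine tendsto_lintegral_filter_of_dominated_convergence (fun a => 4 * ‖F a‖ₑ ^ 2) ?_ ?_ ?_ ?_
    · refine Filter.Eventually.of_forall fun l => Measurable.pow_const (Measurable.enorm ?_) 2
      exact ((continuous_expi.measurable.comp (hθ l)).sub
        (continuous_expi.measurable.comp (hθ l₀))).mul hF
    · refine Filter.Eventually.of_forall fun l => Filter.Eventually.of_forall fun a => ?_
      rw [enorm_mul, mul_pow]
      gcongr
      have : ‖expi (θ l a) - expi (θ l₀ a)‖ₑ ≤ 2 := by
        refine enorm_sub_le.trans ?_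
        rw [enorm_expi, enorm_expi]
        norm_num
      calc _ ≤ (2 : ℝ≥0∞) ^ 2 := by gcongr
        _ = 4 := by norm_num
    · rw [lintegral_const_mul _ (hF.enorm.pow_const 2)]
      exact ENNReal.mul_ne_top (by norm_num) (MemLp.lintegral_enorm_sq_ne_top (Lp.memLp F))
    · refine Filter.Eventually.of_forall fun a => ?_
      have : Continuous fun l => ‖(expi (θ l a) - expi (θ l₀ a)) * F a‖ₑ ^ 2 := by
        have := hc a
        fun_prop
      simpa using this.tendsto l₀
  simp_rw [← h1] at h2
  have h3 := (ENNReal.continuous_rpow_const (y := (1 / 2 : ℝ))).tendsto 0 |>.comp h2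
  rw [ENNReal.zero_rpow_of_pos (by norm_num)] at h3
  refine h3.congr fun l => ?_
  rw [Function.comp_apply, ← ENNReal.rpow_natCast, ← ENNReal.rpow_mul]
  norm_num

/-- Continuity in the parameter for each fixed vector becomes joint continuity because all the
operators are 1-Lipschitz. -/
theorem continuous_expMul {Λ : Type*} [TopologicalSpace Λ] [FirstCountableTopology Λ]
    {θ : Λ → α → ℝ} (hθ : ∀ l, Measurable (θ l)) (hc : ∀ a, Continuous fun l => θ l a) :
    Continuous fun x : Λ × Lp ℂ 2 μ => expMul (θ x.1) (hθ x.1) x.2 :=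
  continuous_prod_of_continuous_lipschitzWith'
    (fun x : Λ × Lp ℂ 2 μ => expMul (θ x.1) (hθ x.1) x.2) 1
    (fun l => (expMul (θ l) (hθ l)).lipschitz)
    (fun F => continuous_expMul_apply hθ hc F)

end expMul

/-! ### Rank one operators -/

theorem coeFn_tensor {d : ℕ} (f u : L2R d) :
    tensor f u =ᵐ[volume] fun p => f p.1 * (starRingEnd ℂ) (u p.2) :=
  MemLp.coeFn_toLp _

theorem inner_tensor_tensor {d : ℕ} (f g u v : L2R d) :
    inner ℂ (tensor f u) (tensor g v) = inner ℂ f g * inner ℂ v u := by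
  rw [L2.inner_def, L2.inner_def, L2.inner_def, ← integral_prod_mul]
  refine integral_congr_ae ?_
  filter_upwards [coeFn_tensor f u, coeFn_tensor g v] with p h1 h2
  rw [h1, h2]
  simp only [RCLike.inner_apply, map_mul, RCLike.conj_conj]
  ring

theorem norm_tensor {d : ℕ} (f u : L2R d) : ‖tensor f u‖ = ‖f‖ * ‖u‖ := by
  have h := inner_tensor_tensor f f u u
  rw [inner_self_eq_norm_sq_to_K, inner_self_eq_norm_sq_to_K, inner_self_eq_norm_sq_to_K] at h
  have h2 : ‖tensor f u‖ ^ 2 = (‖f‖ * ‖u‖) ^ 2 := by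
    rw [mul_pow]
    exact_mod_cast h
  exact (pow_left_inj₀ (norm_nonneg _) (by positivity) two_ne_zero).1 h2

/-! ### The representations `π_λ` and the covariance of the Plancherel transform -/

namespace ExpGroup

variable {p d : ℕ} {𝔫 : Type*} [LieRing 𝔫] [LieAlgebra ℝ 𝔫] (D : NilpotentAlgebra p d 𝔫)

/-- The commutator term of the group law, paired with `λ`, is the phase created by moving a
translation past a modulation. It gives `t·B(y + y') - x·By' = t·By + (t - x)·By'`, which makes
`π_λ` multiplicative. -/
theorem dotProduct_coordZ_lie (l : Fin p → ℝ) (x y : Fin d → ℝ) :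
    l ⬝ᵥ D.coordZ ⁅D.sumX x, D.sumY y⁆ = -(x ⬝ᵥ (D.B l *ᵥ y)) := by
  have h : ∀ v, l ⬝ᵥ D.coordZ v = D.functional l v := fun v => by
    simp [dotProduct, NilpotentAlgebra.coordZ, NilpotentAlgebra.functional]
  rw [h]
  simp only [NilpotentAlgebra.sumX, NilpotentAlgebra.sumY, sum_lie, lie_sum, smul_lie, lie_smul,
    map_sum, map_smul, dotProduct, Matrix.mulVec, NilpotentAlgebra.B, Matrix.of_apply,
    smul_eq_mul, Finset.mul_sum, neg_mul, mul_neg, Finset.sum_neg_distrib, neg_neg]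
  rw [Finset.sum_comm]
  refine Finset.sum_congr rfl fun i _ => Finset.sum_congr rfl fun j _ => ?_
  ring

theorem coeFn_rep (l : Fin p → ℝ) (n : ExpGroup D) (F : L2R d) :
    rep D l n F =ᵐ[volume] fun t =>
      expi (l ⬝ᵥ (coords D n).1 + t ⬝ᵥ (D.B l *ᵥ (coords D n).2.1)) *
        F (t - (coords D n).2.2) := by
  filter_upwards [Lp.coeFn_smul (expi (l ⬝ᵥ (coords D n).1))
    (timeFreq (D.B l *ᵥ (coords D n).2.1) (coords D n).2.2 F),
    coeFn_timeFreq (D.B l *ᵥ (coords D n).2.1) (coords D n).2.2 F] with t h1 h2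
  change (expi (l ⬝ᵥ (coords D n).1) •
    timeFreq (D.B l *ᵥ (coords D n).2.1) (coords D n).2.2 F : L2R d) t = _
  rw [h1, Pi.smul_apply, h2, expi_add, smul_eq_mul, mul_assoc]

theorem rep_mul (l : Fin p → ℝ) (g h : ExpGroup D) (F : L2R d) :
    rep D l (g * h) F = rep D l g (rep D l h F) := by
  refine Lp.ext ?_
  filter_upwards [coeFn_rep D l (g * h) F, coeFn_rep D l g (rep D l h F),
    (measurePreserving_sub_right volume (coords D g).2.2).quasiMeasurePreserving.ae
      (coeFn_rep D l h F)] with t h1 h2 h3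
  rw [h1, h2, h3, ← mul_assoc, ← expi_add, coords_mul]
  congr 2
  · simp only [dotProduct_add, dotProduct_coordZ_lie, Matrix.mulVec_add, sub_dotProduct]
    ring
  · rw [sub_sub]

theorem coords_one : coords D 1 = 0 := by
  have : coords D (1 * 1) = coords D 1 := by rw [one_mul]
  rw [coords_mul] at this
  have h1 : (coords D 1).2.1 = 0 := by
    have := congrArg (fun c => c.2.1) this
    simpa using this
  have h2 : (coords D 1).2.2 = 0 := by
    have := congrArg (fun c => c.2.2) this
    simpa using this
  have h3 : (coords D 1).1 = 0 := by
    have := congrArg (fun c => c.1) this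
    simpa [h2, NilpotentAlgebra.sumX] using this
  exact Prod.ext h3 (Prod.ext h1 h2)

theorem rep_one (l : Fin p → ℝ) (F : L2R d) : rep D l 1 F = F := by
  refine Lp.ext ?_
  filter_upwards [coeFn_rep D l 1 F] with t h1
  rw [h1, coords_one]
  simp [expi_zero]

theorem rep_surjective (l : Fin p → ℝ) (n : ExpGroup D) : Function.Surjective (rep D l n) :=
  fun F => ⟨rep D l n⁻¹ F, by rw [← rep_mul, mul_inv_cancel, rep_one]⟩

/-- The phase of the kernel of `π_λ(n) T`. -/
def phase (n : ExpGroup D) (l : Fin p → ℝ) (s : (Fin d → ℝ) × (Fin d → ℝ)) : ℝ :=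
  l ⬝ᵥ (coords D n).1 + s.1 ⬝ᵥ (D.B l *ᵥ (coords D n).2.1)

theorem continuous_phase (n : ExpGroup D) :
    Continuous fun x : (Fin p → ℝ) × ((Fin d → ℝ) × (Fin d → ℝ)) => phase D n x.1 x.2 := by
  have := D.continuous_B
  unfold phase
  fun_prop

theorem measurable_phase (n : ExpGroup D) (l : Fin p → ℝ) : Measurable (phase D n l) :=
  ((continuous_phase D n).comp (Continuous.prodMk_right l)).measurable

theorem measurePreserving_sub_fst (x : Fin d → ℝ) :
    MeasurePreserving (fun s : (Fin d → ℝ) × (Fin d → ℝ) => (s.1 - x, s.2)) volume volume :=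
  (measurePreserving_sub_right volume x).prod (MeasurePreserving.id volume)

/-- Translation in the first variable of the kernel. -/
def shiftHS (x : Fin d → ℝ) : HS d →ₗᵢ[ℂ] HS d :=
  Lp.compMeasurePreservingₗᵢ ℂ _ (measurePreserving_sub_fst x)

theorem coeFn_shiftHS (x : Fin d → ℝ) (k : HS d) :
    shiftHS x k =ᵐ[volume] fun s => k (s.1 - x, s.2) :=
  Lp.coeFn_compMeasurePreserving k (measurePreserving_sub_fst x)

/-- The operator `T ↦ π_λ(n) T` on Hilbert–Schmidt operators. -/
def repHS (l : Fin p → ℝ) (n : ExpGroup D) : HS d →ₗᵢ[ℂ] HS d :=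
  (expMul (phase D n l) (measurable_phase D n l)).comp
    (shiftHS (coords D n).2.2)

theorem coeFn_repHS (l : Fin p → ℝ) (n : ExpGroup D) (k : HS d) :
    repHS D l n k =ᵐ[volume] fun s =>
      expi (phase D n l s) * k (s.1 - (coords D n).2.2, s.2) := by
  filter_upwards [coeFn_expMul (measurable_phase D n l) (shiftHS (coords D n).2.2 k),
    coeFn_shiftHS (coords D n).2.2 k] with s h1 h2
  exact h1.trans (congrArg _ h2)

theorem repHS_tensor (l : Fin p → ℝ) (n : ExpGroup D) (f u : L2R d) :
    repHS D l n (tensor f u) = tensor (rep D l n f) u := by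
  refine Lp.ext ?_
  filter_upwards [coeFn_repHS D l n (tensor f u), coeFn_tensor (rep D l n f) u,
    (measurePreserving_sub_fst (coords D n).2.2).quasiMeasurePreserving.ae (coeFn_tensor f u),
    Measure.quasiMeasurePreserving_fst.ae (coeFn_rep D l n f)] with s h1 h2 h3 h4
  rw [h1, h2, h3, h4, phase, mul_assoc]

theorem norm_rep (l : Fin p → ℝ) (n : ExpGroup D) (F : L2R d) : ‖rep D l n F‖ = ‖F‖ := by
  rw [Lp.norm_def, Lp.norm_def, eLpNorm_congr_ae (coeFn_rep D l n F)]
  congr 1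
  rw [← eLpNorm_comp_measurePreserving (Lp.aestronglyMeasurable F)
    (measurePreserving_sub_right volume (coords D n).2.2)]
  refine eLpNorm_congr_norm_ae (Filter.Eventually.of_forall fun t => ?_)
  simp [norm_expi]

/-- Joint continuity in `(λ, T)` gives the strong measurability of fields `λ ↦ π_λ(n)Φ(λ)`. Only the
phase depends on `λ`; the translation does not. -/
theorem continuous_repHS (n : ExpGroup D) :
    Continuous fun x : (Fin p → ℝ) × HS d => repHS D x.1 n x.2 := by
  have hc : ∀ s, Continuous fun l => phase D n l s := fun s =>
    (continuous_phase D n).comp (continuous_id.prodMk continuous_const)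
  have h1 : Continuous fun x : (Fin p → ℝ) × HS d =>
      expMul (phase D n x.1) (measurable_phase D n x.1) x.2 :=
    continuous_expMul (θ := phase D n) (measurable_phase D n) hc
  have h2 : Continuous fun x : (Fin p → ℝ) × HS d =>
      (x.1, shiftHS (coords D n).2.2 x.2) :=
    continuous_fst.prodMk ((shiftHS (coords D n).2.2).continuous.comp continuous_snd)
  exact h1.comp h2

theorem memLp_repField (n : ExpGroup D) (Φ : DirectIntegral D) :
    MemLp (fun l => repHS D l n (Φ l)) 2 D.plancherelMeasure := by
  refine (Lp.memLp Φ).congr_norm ?_ (Filter.Eventually.of_forall fun l => ?_)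
  · have h : AEStronglyMeasurable (fun l => (l, Φ l)) D.plancherelMeasure :=
      aestronglyMeasurable_id.prodMk (Lp.aestronglyMeasurable Φ)
    exact Continuous.comp_aestronglyMeasurable
      (g := fun x : (Fin p → ℝ) × HS d => repHS D x.1 n x.2) (f := fun l => (l, Φ l))
      (continuous_repHS D n) h
  · exact ((repHS D l n).norm_map _).symm

/-- The operator `∫^⊕ π_λ(n) ⊗ 1 dμ(λ)` on the direct integral. -/
def repField (n : ExpGroup D) : DirectIntegral D →ₗᵢ[ℂ] DirectIntegral D where
  toFun Φ := (memLp_repField D n Φ).toLp _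
  map_add' Φ Ψ := by
    rw [← MemLp.toLp_add]
    refine MemLp.toLp_congr _ _ ?_
    filter_upwards [Lp.coeFn_add Φ Ψ] with l hl
    change repHS D l n ((Φ + Ψ : DirectIntegral D) l) = repHS D l n (Φ l) + repHS D l n (Ψ l)
    rw [hl, Pi.add_apply, map_add]
  map_smul' c Φ := by
    rw [RingHom.id_apply, ← MemLp.toLp_const_smul]
    refine MemLp.toLp_congr _ _ ?_
    filter_upwards [Lp.coeFn_smul c Φ] with l hl
    simp [hl]
  norm_map' Φ := by
    change ‖(memLp_repField D n Φ).toLp _‖ = _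
    rw [Lp.norm_toLp, Lp.norm_def]
    congr 1
    exact eLpNorm_congr_norm_ae (Filter.Eventually.of_forall fun l => (repHS D l n).norm_map _)

theorem coeFn_repField (n : ExpGroup D) (Φ : DirectIntegral D) :
    repField D n Φ =ᵐ[D.plancherelMeasure] fun l => repHS D l n (Φ l) :=
  MemLp.coeFn_toLp (memLp_repField D n Φ)

theorem inner_rep_rep (l : Fin p → ℝ) (n : ExpGroup D) (F G : L2R d) :
    inner ℂ (rep D l n F) (rep D l n G) = inner ℂ F G := by
  obtain rfl | hF := eq_or_ne F 0
  · have : rep D l n 0 = 0 := by rw [← norm_eq_zero, norm_rep, norm_zero]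
    rw [this, inner_zero_left, inner_zero_left]
  -- Unitarity of `π_λ(n)` is read off from its isometric action on kernels: a common second factor
  -- `F` contributes `‖F‖²` to both sides and cancels.
  have h := (repHS D l n).inner_map_map (tensor F F) (tensor G F)
  rw [repHS_tensor, repHS_tensor, inner_tensor_tensor, inner_tensor_tensor] at h
  exact mul_right_cancel₀ (inner_self_ne_zero.2 hF) h

/-- Left translation by a fixed element, as a measurable equivalence. -/
def mulLeftMeas (γ : ExpGroup D) : ExpGroup D ≃ᵐ ExpGroup D where
  toEquiv := Equiv.mulLeft γ
  measurable_toFun := (measurePreserving_mul_left D γ).measurable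
  measurable_invFun := (measurePreserving_mul_left D γ⁻¹).measurable

theorem coeFn_leftRegular (γ : ExpGroup D) (φ : L2N D) :
    leftRegular D γ φ =ᵐ[haar D] fun n => φ (γ⁻¹ * n) :=
  Lp.coeFn_compMeasurePreserving φ (measurePreserving_mul_left D γ⁻¹)

theorem isFourierAt_leftRegular {φ : L2N D} {l : Fin p → ℝ} {k : HS d}
    (h : IsFourierAt D φ l k) (γ : ExpGroup D) :
    IsFourierAt D (leftRegular D γ φ) l (repHS D l γ k) := by
  intro f f'
  -- With the test vector written as `π_λ(γ)f''`, the substitution `n ↦ γn`, left invariance of the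
  -- Haar measure and unitarity remove `γ` from both sides.
  obtain ⟨f'', rfl⟩ := rep_surjective D l γ f'
  have e : ∫ n, leftRegular D γ φ n * inner ℂ (rep D l γ f'') (rep D l n f) ∂haar D =
      ∫ n, φ (γ⁻¹ * n) * inner ℂ (rep D l γ f'') (rep D l n f) ∂haar D := by
    refine integral_congr_ae ?_
    filter_upwards [coeFn_leftRegular D γ φ] with n hn
    rw [hn]
  rw [← repHS_tensor, LinearIsometry.inner_map_map, h, e]
  have hm : MeasurePreserving (mulLeftMeas D γ) (haar D) (haar D) := measurePreserving_mul_left D γ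
  refine Eq.trans ?_ (hm.integral_comp'
    fun n => φ (γ⁻¹ * n) * inner ℂ (rep D l γ f'') (rep D l n f))
  refine integral_congr_ae (Filter.Eventually.of_forall fun n => ?_)
  change _ = φ (γ⁻¹ * (γ * n)) * inner ℂ (rep D l γ f'') (rep D l (γ * n) f)
  rw [inv_mul_cancel_left, rep_mul, inner_rep_rep]

theorem mem_fourierGraph_leftRegular (γ : ExpGroup D) {x : L2N D × DirectIntegral D}
    (hx : x ∈ fourierGraph D) : (leftRegular D γ x.1, repField D γ x.2) ∈ fourierGraph D := by
  refine ⟨?_, ?_⟩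
  · exact ((measurePreserving_mul_left D γ⁻¹).integrable_comp_of_integrable hx.1).congr
      (coeFn_leftRegular D γ x.1).symm
  · filter_upwards [hx.2, coeFn_repField D γ x.2] with l h1 h2
    rw [h2]
    exact isFourierAt_leftRegular D h1 γ

/-- Covariance on the Fourier graph passes to its closed span, since the pair of operators is linear
and continuous. -/
theorem isPlancherelTransform_leftRegular {φ : L2N D} {Φ : DirectIntegral D}
    (h : IsPlancherelTransform D φ Φ) (γ : ExpGroup D) :
    IsPlancherelTransform D (leftRegular D γ φ) (repField D γ Φ) := by
  let T : L2N D × DirectIntegral D →ₗ[ℂ] L2N D × DirectIntegral D :=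
    (leftRegular D γ).toLinearMap.prodMap (repField D γ).toLinearMap
  have hT : Continuous T := (leftRegular D γ).continuous.prodMap (repField D γ).continuous
  have hmaps : Set.MapsTo T (Submodule.span ℂ (fourierGraph D))
      (Submodule.span ℂ (fourierGraph D)) := by
    intro x hx
    have : Submodule.span ℂ (fourierGraph D) ≤ (Submodule.span ℂ (fourierGraph D)).comap T :=
      Submodule.span_le.2 fun y hy =>
        Submodule.subset_span (mem_fourierGraph_leftRegular D γ hy)
    exact this hx
  exact hmaps.closure hT h

end ExpGroup

/-- An integrable function on a product whose integrals over all rectangles vanish is zero. -/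
theorem ae_eq_zero_of_forall_setIntegral_prod_eq_zero {α β : Type*} [MeasurableSpace α]
    [MeasurableSpace β] {μ : Measure α} {ν : Measure β} [SFinite μ] [SFinite ν]
    {φ : α × β → ℂ} (hφ : Integrable φ (μ.prod ν))
    (h : ∀ s t, MeasurableSet s → MeasurableSet t → ∫ x in s ×ˢ t, φ x ∂μ.prod ν = 0) :
    φ =ᵐ[μ.prod ν] 0 := by
  suffices H : ∀ E, MeasurableSet E → ∫ x in E, φ x ∂μ.prod ν = 0 from
    hφ.ae_eq_zero_of_forall_setIntegral_eq_zero fun E hE _ => H E hE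
  intro E hE
  induction E, hE using MeasurableSpace.induction_on_inter generateFrom_prod.symm
    isPiSystem_prod with
  | empty => simp
  | basic E hE =>
    obtain ⟨s, hs, t, ht, rfl⟩ := hE
    exact h s t hs ht
  | compl E hE ih =>
    have hE' := setIntegral_compl hE hφ
    have hu := h _ _ MeasurableSet.univ MeasurableSet.univ
    rw [Set.univ_prod_univ, setIntegral_univ] at hu
    rw [hE', ih, hu, sub_zero]
  | iUnion E hd hE ih =>
    rw [integral_iUnion hE hd hφ.integrableOn]
    simp [ih]

/-! ### Partial Fourier transform -/

section partialFourier

variable {p d : ℕ}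

/-- The Fourier transform in the variables `(z, y)` of a function of `((z, y), x)`. -/
def partialFourier (F : ((Fin p → ℝ) × (Fin d → ℝ)) × (Fin d → ℝ) → ℂ)
    (l : Fin p → ℝ) (ξ x : Fin d → ℝ) : ℂ :=
  ∫ w : (Fin p → ℝ) × (Fin d → ℝ), expi (l ⬝ᵥ w.1 + ξ ⬝ᵥ w.2) * F (w, x)

variable {F : ((Fin p → ℝ) × (Fin d → ℝ)) × (Fin d → ℝ) → ℂ}

theorem measurable_partialFourier (hF : Measurable F) :
    Measurable fun q : ((Fin p → ℝ) × (Fin d → ℝ)) × (Fin d → ℝ) =>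
      partialFourier F q.1.1 q.1.2 q.2 := by
  have h : StronglyMeasurable fun q : (((Fin p → ℝ) × (Fin d → ℝ)) × (Fin d → ℝ)) ×
      ((Fin p → ℝ) × (Fin d → ℝ)) =>
        expi (q.1.1.1 ⬝ᵥ q.2.1 + q.1.1.2 ⬝ᵥ q.2.2) * F (q.2, q.1.2) := by
    refine Measurable.stronglyMeasurable (Measurable.mul ?_ ?_)
    · exact Continuous.measurable (by fun_prop)
    · exact hF.comp (measurable_snd.prodMk measurable_fst.snd)
  exact h.integral_prod_right'.measurable

theorem enorm_partialFourier_le (l : Fin p → ℝ) (ξ x : Fin d → ℝ) :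
    ‖partialFourier F l ξ x‖ₑ ≤ ∫⁻ w, ‖F (w, x)‖ₑ := by
  refine (enorm_integral_le_lintegral_enorm _).trans (lintegral_mono fun w => ?_)
  rw [enorm_mul, enorm_expi, one_mul]

/-- Euclidean Plancherel on each slice of fixed `x`; almost every slice is both integrable and
square integrable. -/
theorem lintegral_enorm_sq_partialFourier (hFm : Measurable F) (hF : Integrable F)
    (hF2 : MemLp F 2) :
    ∫⁻ x, ∫⁻ q : (Fin p → ℝ) × (Fin d → ℝ), ‖partialFourier F q.1 q.2 x‖ₑ ^ 2 =
      ∫⁻ v, ‖F v‖ₑ ^ 2 := by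
  have hm : Measurable fun v => ‖F v‖ₑ ^ 2 := hFm.enorm.pow_const 2
  have e : ∫⁻ v, ‖F v‖ₑ ^ 2 = ∫⁻ x, ∫⁻ w, ‖F (w, x)‖ₑ ^ 2 :=
    lintegral_prod_symm' _ hm
  have hfin : ∀ᵐ x, ∫⁻ w, ‖F (w, x)‖ₑ ^ 2 < ∞ := by
    refine ae_lt_top hm.lintegral_prod_left' ?_
    rw [← e]
    exact MemLp.lintegral_enorm_sq_ne_top hF2
  rw [e]
  refine lintegral_congr_ae ?_
  filter_upwards [hF.prod_left_ae, hfin] with x h1 h2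
  refine lintegral_enorm_sq_integral_expi_prod h1 (memLp_two_of_lintegral_ne_top ?_ h2.ne)
  exact (hFm.comp measurable_prodMk_right).aestronglyMeasurable

end partialFourier

/-! ### The integral kernel of the group Fourier transform -/

namespace ExpGroup

variable {p d : ℕ} {𝔫 : Type*} [LieRing 𝔫] [LieAlgebra ℝ 𝔫] (D : NilpotentAlgebra p d 𝔫)

/-- The parametrization of `N` by the coordinates `((z, y), x)`. -/
def prodCoords : ((Fin p → ℝ) × (Fin d → ℝ)) × (Fin d → ℝ) ≃ᵐ ExpGroup D :=
  MeasurableEquiv.prodAssoc.trans (coordsMeas D).symm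

theorem measurePreserving_prodCoords : MeasurePreserving (prodCoords D) volume (haar D) :=
  ((measurePreserving_coords D).symm (coordsMeas D)).comp volume_preserving_prodAssoc

theorem coords_prodCoords (v : ((Fin p → ℝ) × (Fin d → ℝ)) × (Fin d → ℝ)) :
    coords D (prodCoords D v) = (v.1.1, v.1.2, v.2) :=
  (coords D).apply_symm_apply _

theorem measurable_kernel {F : ((Fin p → ℝ) × (Fin d → ℝ)) × (Fin d → ℝ) → ℂ}
    (hF : Measurable F) (l : Fin p → ℝ) :
    Measurable fun s : (Fin d → ℝ) × (Fin d → ℝ) =>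
      partialFourier F l ((D.B l)ᵀ *ᵥ s.1) (s.1 - s.2) := by
  have hc : Continuous fun s : (Fin d → ℝ) × (Fin d → ℝ) =>
      ((l, (D.B l)ᵀ *ᵥ s.1), s.1 - s.2) := by fun_prop
  have h := (measurable_partialFourier hF).comp hc.measurable
  exact h

/-- For each `t`, the integral of the absolute value in `s` is at most the `L¹` norm of `F`; so
finite measure is required in the first variable only. -/
theorem integrable_kernel {F : ((Fin p → ℝ) × (Fin d → ℝ)) × (Fin d → ℝ) → ℂ}
    (hFm : Measurable F) (hF : Integrable F) (l : Fin p → ℝ) {T : Set (Fin d → ℝ)}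
    (hT : volume T ≠ ∞) (S : Set (Fin d → ℝ)) :
    Integrable (fun s : (Fin d → ℝ) × (Fin d → ℝ) =>
      partialFourier F l ((D.B l)ᵀ *ᵥ s.1) (s.1 - s.2))
      ((volume.restrict T).prod (volume.restrict S)) := by
  have hm := measurable_kernel D hFm l
  refine ⟨hm.aestronglyMeasurable, ?_⟩
  rw [HasFiniteIntegral, lintegral_prod _ hm.enorm.aemeasurable]
  refine lt_of_le_of_lt (b := ∫⁻ _ in T, ∫⁻ v, ‖F v‖ₑ) (lintegral_mono fun t => ?_) ?_
  · calc _ ≤ ∫⁻ s, ‖partialFourier F l ((D.B l)ᵀ *ᵥ t) (t - s)‖ₑ := setLIntegral_le_lintegral _ _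
      _ ≤ ∫⁻ s, ∫⁻ w, ‖F (w, t - s)‖ₑ := lintegral_mono fun s => enorm_partialFourier_le _ _ _
      _ = ∫⁻ x, ∫⁻ w, ‖F (w, x)‖ₑ := lintegral_sub_left_eq_self (fun x => ∫⁻ w, ‖F (w, x)‖ₑ) t
      _ = _ := (lintegral_prod_symm' _ hFm.enorm).symm
  · rw [lintegral_const, Measure.restrict_apply_univ]
    exact ENNReal.mul_lt_top hF.2 hT.lt_top

theorem inner_indicatorConstLp_rep {T S : Set (Fin d → ℝ)} (hT : MeasurableSet T)
    (hS : MeasurableSet S) (hTv : volume T ≠ ∞) (hSv : volume S ≠ ∞) (l : Fin p → ℝ)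
    (n : ExpGroup D) :
    inner ℂ (indicatorConstLp 2 hT hTv (1 : ℂ)) (rep D l n (indicatorConstLp 2 hS hSv (1 : ℂ))) =
      ∫ t in T, expi (l ⬝ᵥ (coords D n).1 + t ⬝ᵥ (D.B l *ᵥ (coords D n).2.1)) *
        S.indicator 1 (t - (coords D n).2.2) := by
  rw [L2.inner_indicatorConstLp_one]
  refine integral_congr_ae (ae_restrict_of_ae ?_)
  filter_upwards [coeFn_rep D l n (indicatorConstLp 2 hS hSv (1 : ℂ)),
    (measurePreserving_sub_right volume (coords D n).2.2).quasiMeasurePreserving.ae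
      (indicatorConstLp_coeFn (p := 2) (hs := hS) (hμs := hSv) (c := (1 : ℂ)))] with t h1 h2
  rw [h1, h2]
  rfl

theorem tensor_indicatorConstLp {T S : Set (Fin d → ℝ)} (hT : MeasurableSet T)
    (hS : MeasurableSet S) (hTv : volume T ≠ ∞) (hSv : volume S ≠ ∞) :
    tensor (indicatorConstLp 2 hT hTv (1 : ℂ)) (indicatorConstLp 2 hS hSv (1 : ℂ)) =
      indicatorConstLp 2 (hT.prod hS)
        (by rw [Measure.volume_eq_prod, Measure.prod_prod]; exact ENNReal.mul_ne_top hTv hSv)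
        (1 : ℂ) := by
  refine Lp.ext ?_
  filter_upwards [coeFn_tensor (indicatorConstLp 2 hT hTv (1 : ℂ))
      (indicatorConstLp 2 hS hSv (1 : ℂ)),
    indicatorConstLp_coeFn (p := 2) (hs := hT.prod hS) (c := (1 : ℂ))
      (hμs := by rw [Measure.volume_eq_prod, Measure.prod_prod]; exact ENNReal.mul_ne_top hTv hSv),
    Measure.quasiMeasurePreserving_fst.ae
      (indicatorConstLp_coeFn (p := 2) (hs := hT) (hμs := hTv) (c := (1 : ℂ))),
    Measure.quasiMeasurePreserving_snd.ae
      (indicatorConstLp_coeFn (p := 2) (hs := hS) (hμs := hSv) (c := (1 : ℂ)))] with s h1 h2 h3 h4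
  rw [h1, h2, h3, h4]
  by_cases ht : s.1 ∈ T <;> by_cases hs : s.2 ∈ S <;> simp [ht, hs, Set.mem_prod]

/-- The matrix coefficients of `∫ f(n) π_λ(n) dn` on indicator functions, in terms of its kernel. -/
theorem integral_mul_inner_rep_indicator {f : ExpGroup D → ℂ} (hfm : Measurable f)
    (hf : Integrable f (haar D))
    {T S : Set (Fin d → ℝ)} (hT : MeasurableSet T)
    (hS : MeasurableSet S) (hTv : volume T ≠ ∞) (hSv : volume S ≠ ∞) (l : Fin p → ℝ) :
    ∫ n, f n * inner ℂ (indicatorConstLp 2 hT hTv (1 : ℂ))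
        (rep D l n (indicatorConstLp 2 hS hSv (1 : ℂ))) ∂haar D =
      ∫ s in T ×ˢ S, partialFourier (fun v => f (prodCoords D v)) l ((D.B l)ᵀ *ᵥ s.1)
        (s.1 - s.2) := by
  have hp := measurePreserving_prodCoords D
  set F : ((Fin p → ℝ) × (Fin d → ℝ)) × (Fin d → ℝ) → ℂ := fun v => f (prodCoords D v) with hFdef
  have hFm : Measurable F := hfm.comp (prodCoords D).measurable
  have hF : Integrable F := hp.integrable_comp_of_integrable hf
  have hind : Measurable (S.indicator (1 : (Fin d → ℝ) → ℂ)) := measurable_one.indicator hS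
  rw [← hp.integral_comp']
  simp_rw [inner_indicatorConstLp_rep, coords_prodCoords]
  set G : (((Fin p → ℝ) × (Fin d → ℝ)) × (Fin d → ℝ)) → (Fin d → ℝ) → ℂ := fun v t =>
    F v * (expi (l ⬝ᵥ v.1.1 + t ⬝ᵥ (D.B l *ᵥ v.1.2)) * S.indicator 1 (t - v.2)) with hG
  -- The integrand is dominated by `|F|`, which is integrable on the product because `T` has finite
  -- measure; this justifies Fubini.
  have hGi : Integrable (Function.uncurry G) (volume.prod (volume.restrict T)) := by
    have hb : Integrable (fun q : (((Fin p → ℝ) × (Fin d → ℝ)) × (Fin d → ℝ)) × (Fin d → ℝ) =>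
        F q.1 * (1 : ℂ)) (volume.prod (volume.restrict T)) := by
      have : IsFiniteMeasure (volume.restrict T) := ⟨by simpa using hTv.lt_top⟩
      exact hF.mul_prod (integrable_const 1)
    refine hb.mono ?_ (Filter.Eventually.of_forall fun q => ?_)
    · refine Measurable.aestronglyMeasurable ((hFm.comp measurable_fst).mul (Measurable.mul ?_ ?_))
      · exact Continuous.measurable (by fun_prop)
      · exact hind.comp (Continuous.measurable (by fun_prop))
    · simp only [hG, Function.uncurry, norm_mul, norm_expi, one_mul, mul_one]
      refine mul_le_of_le_one_right (norm_nonneg _) ?_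
      by_cases h : q.2 - q.1.2 ∈ S <;> simp [h]
  have e1 : ∫ v, F v * ∫ t in T, expi (l ⬝ᵥ v.1.1 + t ⬝ᵥ (D.B l *ᵥ v.1.2)) *
      S.indicator 1 (t - v.2) = ∫ t in T, ∫ v, G v t := by
    rw [← integral_integral_swap hGi]
    simp_rw [hG, integral_const_mul]
  have hker := integrable_kernel D hFm hF l hTv S
  have e0 : (volume : Measure ((Fin d → ℝ) × (Fin d → ℝ))).restrict (T ×ˢ S) =
      (volume.restrict T).prod (volume.restrict S) := (Measure.prod_restrict T S).symm
  rw [e1, e0, integral_prod _ hker]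
  refine integral_congr_ae ?_
  filter_upwards [hGi.prod_left_ae] with t ht
  have e2 : ∫ v, G v t = ∫ x, ∫ w, G (w, x) t := integral_prod_symm _ ht
  -- The substitution `x = t - s` turns the translation parameter into the second variable of the
  -- kernel.
  rw [e2, ← integral_sub_left_eq_self _ volume t, ← integral_indicator hS]
  refine integral_congr_ae (Filter.Eventually.of_forall fun s => ?_)
  have e3 : ∀ w, G (w, t - s) t = S.indicator 1 s *
      (expi (l ⬝ᵥ w.1 + ((D.B l)ᵀ *ᵥ t) ⬝ᵥ w.2) * F (w, t - s)) := fun w => by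
    simp only [hG, sub_sub_cancel, Matrix.mulVec_transpose, Matrix.dotProduct_mulVec]
    ring
  simp_rw [e3, integral_const_mul]
  by_cases hs : s ∈ S <;> simp [hs, partialFourier]

/-- The kernel of the operator-valued Fourier transform. -/
theorem IsFourierAt.ae_eq_partialFourier {f : ExpGroup D → ℂ} (hfm : Measurable f)
    (hf : Integrable f (haar D)) {l : Fin p → ℝ} {k : HS d} (h : IsFourierAt D f l k) :
    k =ᵐ[volume] fun s => partialFourier (fun v => f (prodCoords D v)) l ((D.B l)ᵀ *ᵥ s.1)
      (s.1 - s.2) := by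
  have hp := measurePreserving_prodCoords D
  set K := fun s : (Fin d → ℝ) × (Fin d → ℝ) =>
    partialFourier (fun v => f (prodCoords D v)) l ((D.B l)ᵀ *ᵥ s.1) (s.1 - s.2) with hK
  -- The kernels are compared on products of balls, where both are integrable, by testing the weak
  -- identity on indicators of rectangles.
  have hball : ∀ m : ℕ, ∀ᵐ s : (Fin d → ℝ) × (Fin d → ℝ), s ∈ Metric.ball (0 : Fin d → ℝ) m ×ˢ
      Metric.ball (0 : Fin d → ℝ) m → k s - K s = 0 := by
    intro m
    set T := Metric.ball (0 : Fin d → ℝ) m with hTdef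
    have hT : MeasurableSet T := Metric.isOpen_ball.measurableSet
    have hTv : volume T ≠ ∞ := Metric.isBounded_ball.measure_lt_top.ne
    have hKi : Integrable K ((volume.restrict T).prod (volume.restrict T)) :=
      integrable_kernel D (hfm.comp (prodCoords D).measurable)
        (hp.integrable_comp_of_integrable hf) l hTv T
    have hTT : volume (T ×ˢ T) ≠ ∞ := by
      rw [Measure.volume_eq_prod, Measure.prod_prod]
      exact ENNReal.mul_ne_top hTv hTv
    have hki : Integrable k ((volume.restrict T).prod (volume.restrict T)) := by
      rw [Measure.prod_restrict]
      have : IsFiniteMeasure (volume.restrict (T ×ˢ T)) := ⟨by simpa using hTT.lt_top⟩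
      exact ((Lp.memLp k).restrict (T ×ˢ T)).integrable (by norm_num)
    have key := ae_eq_zero_of_forall_setIntegral_prod_eq_zero (hki.sub hKi) fun s t hs ht => by
      have e : ((volume.restrict T).prod (volume.restrict T)).restrict (s ×ˢ t) =
          volume.restrict ((s ∩ T) ×ˢ (t ∩ T)) := by
        rw [← Measure.prod_restrict, Measure.restrict_restrict hs, Measure.restrict_restrict ht,
          Measure.prod_restrict, Measure.volume_eq_prod]
      have hsT : volume (s ∩ T) ≠ ∞ := ne_top_of_le_ne_top hTv (measure_mono Set.inter_subset_right)
      have htT : volume (t ∩ T) ≠ ∞ := ne_top_of_le_ne_top hTv (measure_mono Set.inter_subset_right)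
      have h1 := h (indicatorConstLp 2 (ht.inter hT) htT (1 : ℂ))
        (indicatorConstLp 2 (hs.inter hT) hsT (1 : ℂ))
      rw [integral_mul_inner_rep_indicator D hfm hf, tensor_indicatorConstLp,
        L2.inner_indicatorConstLp_one] at h1
      rw [integral_sub' hki.integrableOn hKi.integrableOn, e, h1, sub_self]
    rw [Measure.prod_restrict, Filter.EventuallyEq,
      ae_restrict_iff' (hT.prod hT)] at key
    exact key
  filter_upwards [ae_all_iff.2 hball] with s hs
  obtain ⟨m, hm⟩ := exists_nat_gt (max ‖s.1‖ ‖s.2‖)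
  refine sub_eq_zero.1 (hs m ⟨?_, ?_⟩)
  · simpa using (le_max_left _ _).trans_lt hm
  · simpa using (le_max_right _ _).trans_lt hm

end ExpGroup

/-! ### Integration against the Plancherel measure -/

variable {p d : ℕ} {𝔫 : Type*} [LieRing 𝔫] [LieAlgebra ℝ 𝔫] (D : NilpotentAlgebra p d 𝔫)

namespace NilpotentAlgebra

theorem measurable_ofReal_abs_det_B : Measurable fun l => ENNReal.ofReal |(D.B l).det| :=
  (ENNReal.continuous_ofReal.comp D.continuous_det_B.abs).measurable

/-- The density vanishes off the cross-section, so the restriction can be dropped. -/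
theorem plancherelMeasure_eq :
    D.plancherelMeasure = volume.withDensity fun l => ENNReal.ofReal |(D.B l).det| := by
  rw [plancherelMeasure, ← withDensity_indicator D.measurableSet_crossSection]
  congr 1
  ext l
  by_cases h : (D.B l).det = 0 <;> simp [crossSection, h]

theorem ae_plancherelMeasure_iff {P : (Fin p → ℝ) → Prop} :
    (∀ᵐ l ∂D.plancherelMeasure, P l) ↔ ∀ᵐ l, (D.B l).det ≠ 0 → P l := by
  rw [plancherelMeasure_eq, ae_withDensity_iff D.measurable_ofReal_abs_det_B]
  simp

theorem lintegral_plancherelMeasure {h : (Fin p → ℝ) → ℝ≥0∞} (hh : Measurable h) :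
    ∫⁻ l, h l ∂D.plancherelMeasure = ∫⁻ l, ENNReal.ofReal |(D.B l).det| * h l := by
  rw [plancherelMeasure_eq,
    lintegral_withDensity_eq_lintegral_mul _ D.measurable_ofReal_abs_det_B hh]
  rfl

theorem integral_plancherelMeasure (h : (Fin p → ℝ) → ℂ) :
    ∫ l, h l ∂D.plancherelMeasure = ∫ l, ((|(D.B l).det| : ℝ) : ℂ) * h l := by
  rw [plancherelMeasure_eq, integral_withDensity_eq_integral_toReal_smul
    D.measurable_ofReal_abs_det_B (by simp)]
  simp

end NilpotentAlgebra

namespace ExpGroup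

/-! ### The Plancherel transform is isometric -/

/-- With `M = B(λ)ᵀ` the left side is a squared Hilbert–Schmidt norm. The reflection `s ↦ t - s`
preserves measure, and `t ↦ Mt` produces the Jacobian that the Plancherel density will cancel. -/
theorem lintegral_enorm_sq_partialFourier_mulVec
    {F : ((Fin p → ℝ) × (Fin d → ℝ)) × (Fin d → ℝ) → ℂ} (hF : Measurable F) (l : Fin p → ℝ)
    {M : Matrix (Fin d) (Fin d) ℝ} (hM : M.det ≠ 0) :
    ∫⁻ s : (Fin d → ℝ) × (Fin d → ℝ), ‖partialFourier F l (M *ᵥ s.1) (s.1 - s.2)‖ₑ ^ 2 =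
      ENNReal.ofReal |M.det|⁻¹ * ∫⁻ y, ∫⁻ ξ, ‖partialFourier F l ξ y‖ₑ ^ 2 := by
  have hm := (measurable_partialFourier hF).enorm.pow_const 2
  have hl : Measurable fun q : (Fin d → ℝ) × (Fin d → ℝ) =>
      ‖partialFourier F l q.1 q.2‖ₑ ^ 2 := by
    have hc : Measurable fun q : (Fin d → ℝ) × (Fin d → ℝ) => ((l, q.1), q.2) := by fun_prop
    have h := hm.comp hc
    exact h
  have hk : Measurable fun s : (Fin d → ℝ) × (Fin d → ℝ) =>
      ‖partialFourier F l (M *ᵥ s.1) (s.1 - s.2)‖ₑ ^ 2 := by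
    have hc : Continuous fun s : (Fin d → ℝ) × (Fin d → ℝ) => (M *ᵥ s.1, s.1 - s.2) := by fun_prop
    have h := hl.comp hc.measurable
    exact h
  have ht : Measurable fun s : (Fin d → ℝ) × (Fin d → ℝ) =>
      ‖partialFourier F l (M *ᵥ s.1) s.2‖ₑ ^ 2 := by
    have hc : Continuous fun s : (Fin d → ℝ) × (Fin d → ℝ) => (M *ᵥ s.1, s.2) := by fun_prop
    have h := hl.comp hc.measurable
    exact h
  calc ∫⁻ s : (Fin d → ℝ) × (Fin d → ℝ), ‖partialFourier F l (M *ᵥ s.1) (s.1 - s.2)‖ₑ ^ 2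
      = ∫⁻ t, ∫⁻ s, ‖partialFourier F l (M *ᵥ t) (t - s)‖ₑ ^ 2 :=
        lintegral_prod _ hk.aemeasurable
    _ = ∫⁻ t, ∫⁻ y, ‖partialFourier F l (M *ᵥ t) y‖ₑ ^ 2 :=
        lintegral_congr fun t => lintegral_sub_left_eq_self
          (fun y => ‖partialFourier F l (M *ᵥ t) y‖ₑ ^ 2) t
    _ = ∫⁻ y, ∫⁻ t, ‖partialFourier F l (M *ᵥ t) y‖ₑ ^ 2 :=
        lintegral_lintegral_swap (f := fun t y => ‖partialFourier F l (M *ᵥ t) y‖ₑ ^ 2)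
          ht.aemeasurable
    _ = ∫⁻ y, ENNReal.ofReal |M.det|⁻¹ * ∫⁻ ξ, ‖partialFourier F l ξ y‖ₑ ^ 2 :=
        lintegral_congr fun y => lintegral_comp_mulVec (f := fun ξ => ‖partialFourier F l ξ y‖ₑ ^ 2)
          hM (hl.comp measurable_prodMk_right).aemeasurable
    _ = _ := lintegral_const_mul _ hl.lintegral_prod_left'

/-- Integrating the Hilbert–Schmidt norms against `|det B(λ)| dλ` cancels the Jacobian for almost
every `λ`, as a nonempty cross-section has full measure. What remains is Plancherel in `(z, y)`,
integrated over `x`. -/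
theorem enorm_eq_of_mem_fourierGraph (hS : D.crossSection.Nonempty)
    {x : L2N D × DirectIntegral D} (hx : x ∈ fourierGraph D) : ‖x.2‖ₑ ^ 2 = ‖x.1‖ₑ ^ 2 := by
  have hp := measurePreserving_prodCoords D
  have hfm : Measurable x.1 := (Lp.stronglyMeasurable x.1).measurable
  set F : ((Fin p → ℝ) × (Fin d → ℝ)) × (Fin d → ℝ) → ℂ := fun v => x.1 (prodCoords D v) with hFdef
  have hFm : Measurable F := hfm.comp (prodCoords D).measurable
  have hF : Integrable F := hp.integrable_comp_of_integrable hx.1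
  have hF2 : MemLp F 2 := (Lp.memLp x.1).comp_measurePreserving hp
  have hm := (measurable_partialFourier hFm).enorm.pow_const 2
  have hswap : Measurable fun q : ((Fin p → ℝ) × (Fin d → ℝ)) × (Fin d → ℝ) =>
      ((q.1.1, q.2), q.1.2) := by fun_prop
  have hm1 : Measurable fun q : (Fin p → ℝ) × (Fin d → ℝ) =>
      ∫⁻ ξ, ‖partialFourier F q.1 ξ q.2‖ₑ ^ 2 :=
    (hm.comp hswap).lintegral_prod_right'
  have hm2 : Measurable fun l : Fin p → ℝ => ∫⁻ y, ∫⁻ ξ, ‖partialFourier F l ξ y‖ₑ ^ 2 :=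
    hm1.lintegral_prod_right'
  have key : ∀ᵐ l ∂D.plancherelMeasure, ‖x.2 l‖ₑ ^ 2 = ENNReal.ofReal |(D.B l).det|⁻¹ *
      ∫⁻ y, ∫⁻ ξ, ‖partialFourier F l ξ y‖ₑ ^ 2 := by
    filter_upwards [hx.2, D.ae_plancherelMeasure_iff.2 (Filter.Eventually.of_forall fun _ h => h)]
      with l hl hdet
    have hdet' : ((D.B l)ᵀ).det ≠ 0 := by rwa [Matrix.det_transpose]
    have h := lintegral_enorm_sq_partialFourier_mulVec hFm l hdet'
    rw [Matrix.det_transpose] at h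
    rw [← h, ← lintegral_enorm_sq_Lp]
    refine lintegral_congr_ae ?_
    filter_upwards [hl.ae_eq_partialFourier D hfm hx.1] with s hs
    rw [hs]
  have hm3 : Measurable fun l => ENNReal.ofReal |(D.B l).det|⁻¹ *
      ∫⁻ y, ∫⁻ ξ, ‖partialFourier F l ξ y‖ₑ ^ 2 :=
    D.continuous_det_B.abs.measurable.inv.ennreal_ofReal.mul hm2
  rw [← lintegral_enorm_sq_Lp, lintegral_congr_ae key, D.lintegral_plancherelMeasure hm3]
  calc ∫⁻ l, ENNReal.ofReal |(D.B l).det| * (ENNReal.ofReal |(D.B l).det|⁻¹ *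
        ∫⁻ y, ∫⁻ ξ, ‖partialFourier F l ξ y‖ₑ ^ 2)
      = ∫⁻ l, ∫⁻ y, ∫⁻ ξ, ‖partialFourier F l ξ y‖ₑ ^ 2 := by
        refine lintegral_congr_ae ?_
        filter_upwards [D.ae_mem_crossSection hS] with l hl
        have : 0 < |(D.B l).det| := abs_pos.2 hl
        rw [← mul_assoc, ← ENNReal.ofReal_mul this.le, mul_inv_cancel₀ this.ne',
          ENNReal.ofReal_one, one_mul]
    _ = ∫⁻ y, ∫⁻ l, ∫⁻ ξ, ‖partialFourier F l ξ y‖ₑ ^ 2 :=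
        lintegral_lintegral_swap hm1.aemeasurable
    _ = ∫⁻ y, ∫⁻ q : (Fin p → ℝ) × (Fin d → ℝ), ‖partialFourier F q.1 q.2 y‖ₑ ^ 2 := by
        refine lintegral_congr fun y => ?_
        exact (lintegral_prod _ (hm.comp measurable_prodMk_right).aemeasurable).symm
    _ = ∫⁻ v, ‖F v‖ₑ ^ 2 := lintegral_enorm_sq_partialFourier hFm hF hF2
    _ = ‖x.1‖ₑ ^ 2 := by
        rw [← lintegral_enorm_sq_Lp, ← hp.lintegral_comp_emb (prodCoords D).measurableEmbedding]

/-! ### Extension to the closed graph, and closedness of the band-limited space -/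

theorem aestronglyMeasurable_inner_rep (l : Fin p → ℝ) (h h' : L2R d) :
    AEStronglyMeasurable (fun n => inner ℂ h' (rep D l n h)) (haar D) := by
  have hc : Continuous (coords D) := (coordsHomeo D).continuous
  have hm : StronglyMeasurable fun q : ExpGroup D × (Fin d → ℝ) =>
      inner ℂ (h' q.2) (expi (l ⬝ᵥ (coords D q.1).1 + q.2 ⬝ᵥ (D.B l *ᵥ (coords D q.1).2.1)) *
        h (q.2 - (coords D q.1).2.2)) := by
    refine StronglyMeasurable.inner ((Lp.stronglyMeasurable h').comp_measurable measurable_snd)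
      (StronglyMeasurable.mul ?_ ((Lp.stronglyMeasurable h).comp_measurable ?_))
    · refine (continuous_expi.measurable.comp ?_).stronglyMeasurable
      have h1 : Measurable fun q : ExpGroup D × (Fin d → ℝ) => (coords D q.1, q.2) :=
        (hc.measurable.comp measurable_fst).prodMk measurable_snd
      have h2 : Continuous fun c : ((Fin p → ℝ) × (Fin d → ℝ) × (Fin d → ℝ)) × (Fin d → ℝ) =>
          l ⬝ᵥ c.1.1 + c.2 ⬝ᵥ (D.B l *ᵥ c.1.2.1) := by fun_prop
      exact h2.measurable.comp h1
    · exact measurable_snd.sub ((hc.measurable.comp measurable_fst).snd.snd)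
  refine ((hm.integral_prod_right' (ν := volume)).aestronglyMeasurable).congr
    (Filter.Eventually.of_forall fun n => ?_)
  beta_reduce
  rw [L2.inner_def]
  refine integral_congr_ae ?_
  filter_upwards [coeFn_rep D l n h] with t ht
  rw [ht]

theorem integrable_mul_inner_rep {f : ExpGroup D → ℂ} (hf : Integrable f (haar D))
    (l : Fin p → ℝ) (h h' : L2R d) :
    Integrable (fun n => f n * inner ℂ h' (rep D l n h)) (haar D) := by
  refine hf.mul_bdd (c := ‖h'‖ * ‖h‖) (aestronglyMeasurable_inner_rep D l h h')
    (Filter.Eventually.of_forall fun n => ?_)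
  simpa [norm_rep] using norm_inner_le_norm (𝕜 := ℂ) h' (rep D l n h)

/-- The graph of the Fourier transform on `L¹(N) ∩ L²(N)`, as a subspace. -/
def fourierGraphSubmodule : Submodule ℂ (L2N D × DirectIntegral D) where
  carrier := fourierGraph D
  zero_mem' := by
    refine ⟨(integrable_zero _ ℂ (haar D)).congr (Lp.coeFn_zero ℂ 2 (haar D)).symm, ?_⟩
    filter_upwards [Lp.coeFn_zero (HS d) 2 D.plancherelMeasure] with l hl h h'
    change inner ℂ _ ((0 : DirectIntegral D) l) = ∫ n, (0 : L2N D) n * _ ∂haar D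
    have : ∫ n, (0 : L2N D) n * inner ℂ h' (rep D l n h) ∂haar D = ∫ n, (0 : ℂ) ∂haar D := by
      refine integral_congr_ae ?_
      filter_upwards [Lp.coeFn_zero ℂ 2 (haar D)] with n hn
      rw [hn, Pi.zero_apply, zero_mul]
    rw [hl, this]
    simp
  add_mem' := by
    intro x y hx hy
    refine ⟨(hx.1.add hy.1).congr (Lp.coeFn_add x.1 y.1).symm, ?_⟩
    filter_upwards [hx.2, hy.2, Lp.coeFn_add x.2 y.2] with l h1 h2 hl h h'
    change inner ℂ _ ((x.2 + y.2 : DirectIntegral D) l) =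
      ∫ n, (x.1 + y.1 : L2N D) n * inner ℂ h' (rep D l n h) ∂haar D
    have : ∫ n, (x.1 + y.1 : L2N D) n * inner ℂ h' (rep D l n h) ∂haar D =
        ∫ n, (x.1 n * inner ℂ h' (rep D l n h) + y.1 n * inner ℂ h' (rep D l n h)) ∂haar D := by
      refine integral_congr_ae ?_
      filter_upwards [Lp.coeFn_add x.1 y.1] with n hn
      rw [hn, Pi.add_apply, add_mul]
    rw [hl, Pi.add_apply, inner_add_right, h1, h2, this, integral_add
      (integrable_mul_inner_rep D hx.1 l h h') (integrable_mul_inner_rep D hy.1 l h h')]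
  smul_mem' := by
    intro c x hx
    refine ⟨(hx.1.smul c).congr (Lp.coeFn_smul c x.1).symm, ?_⟩
    filter_upwards [hx.2, Lp.coeFn_smul c x.2] with l h1 hl h h'
    change inner ℂ _ ((c • x.2 : DirectIntegral D) l) =
      ∫ n, (c • x.1 : L2N D) n * inner ℂ h' (rep D l n h) ∂haar D
    have : ∫ n, (c • x.1 : L2N D) n * inner ℂ h' (rep D l n h) ∂haar D =
        ∫ n, c * (x.1 n * inner ℂ h' (rep D l n h)) ∂haar D := by
      refine integral_congr_ae ?_
      filter_upwards [Lp.coeFn_smul c x.1] with n hn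
      rw [hn, Pi.smul_apply, smul_eq_mul, mul_assoc]
    rw [hl, Pi.smul_apply, inner_smul_right, h1, this, integral_const_mul]

/-- The Fourier graph is already a subspace, so its span contains nothing new, and equality of norms
survives closure. In particular each `φ` has at most one transform. -/
theorem norm_eq_of_mem_plancherelGraph (hS : D.crossSection.Nonempty)
    {x : L2N D × DirectIntegral D} (hx : x ∈ plancherelGraph D) : ‖x.2‖ = ‖x.1‖ := by
  have hcl : IsClosed {x : L2N D × DirectIntegral D | ‖x.2‖ = ‖x.1‖} :=
    isClosed_eq continuous_snd.norm continuous_fst.norm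
  have hsp : (Submodule.span ℂ (fourierGraph D) : Set (L2N D × DirectIntegral D)) ⊆
      {x | ‖x.2‖ = ‖x.1‖} := by
    intro y hy
    have hy' : y ∈ fourierGraph D :=
      (Submodule.span_le (p := fourierGraphSubmodule D)).2 (fun z hz => hz) hy
    have h := enorm_eq_of_mem_fourierGraph D hS hy'
    rw [enorm_sq_eq_ofReal, enorm_sq_eq_ofReal, ENNReal.ofReal_eq_ofReal_iff (by positivity)
      (by positivity)] at h
    exact (pow_left_inj₀ (norm_nonneg _) (norm_nonneg _) two_ne_zero).1 h
  exact closure_minimal hsp hcl hx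

/-- Polarization: the graph contains `x ± y` and `x ± iy`. -/
theorem inner_eq_of_mem_plancherelGraph (hS : D.crossSection.Nonempty)
    {x y : L2N D × DirectIntegral D} (hx : x ∈ plancherelGraph D) (hy : y ∈ plancherelGraph D) :
    inner ℂ x.1 y.1 = inner ℂ x.2 y.2 := by
  have h1 := norm_eq_of_mem_plancherelGraph D hS (Submodule.add_mem _ hx hy)
  have h2 := norm_eq_of_mem_plancherelGraph D hS (Submodule.sub_mem _ hx hy)
  have h3 := norm_eq_of_mem_plancherelGraph D hS
    (Submodule.sub_mem _ hx (Submodule.smul_mem _ Complex.I hy))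
  have h4 := norm_eq_of_mem_plancherelGraph D hS
    (Submodule.add_mem _ hx (Submodule.smul_mem _ Complex.I hy))
  simp only [Prod.fst_add, Prod.snd_add, Prod.fst_sub, Prod.snd_sub, Prod.smul_fst,
    Prod.smul_snd] at h1 h2 h3 h4
  rw [inner_eq_sum_norm_sq_div_four, inner_eq_sum_norm_sq_div_four]
  simp only [RCLike.I_to_complex]
  rw [h1, h2, h3, h4]

theorem isClosed_plancherelGraph : IsClosed (plancherelGraph D : Set (L2N D × DirectIntegral D)) :=
  Submodule.isClosed_topologicalClosure _

theorem isClosed_tensorRange {u : L2R d} (hu : ‖u‖ = 1) : IsClosed (tensorRange u : Set (HS d)) := by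
  let T : L2R d →ₗᵢ[ℂ] HS d :=
    { toFun := fun f => tensor f u
      map_add' := fun f g => tensor_add f g u
      map_smul' := fun c f => tensor_smul c f u
      norm_map' := fun f => by
        change ‖tensor f u‖ = _
        rw [norm_tensor, hu, mul_one] }
  exact T.isometry.isClosedEmbedding.isClosed_range

/-- A convergent sequence in `L²` has a subsequence converging almost everywhere, and the fibre
conditions are closed. -/
theorem isClosed_fieldSpace (I : Set (Fin p → ℝ)) {u : L2R d} (hu : ‖u‖ = 1) :
    IsClosed (fieldSpace D I u : Set (DirectIntegral D)) := by
  refine IsSeqClosed.isClosed fun Φ Ψ hΦ hlim => ?_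
  obtain ⟨ns, -, hns⟩ := (tendstoInMeasure_of_tendsto_Lp hlim).exists_seq_tendsto_ae
  change ∀ᵐ l ∂D.plancherelMeasure, _
  filter_upwards [hns, ae_all_iff.2 hΦ] with l hl hm
  refine ⟨fun hlI => ?_, fun hlI => ?_⟩
  · exact (isClosed_tensorRange hu).mem_of_tendsto hl
      (Filter.Eventually.of_forall fun n => (hm (ns n)).1 hlI)
  · refine tendsto_nhds_unique hl ?_
    simp only [(hm _).2 hlI]
    exact tendsto_const_nhds

/-- The space is the image of a closed part of the graph under the first projection. That projection
is isometric there: the product norm is a maximum of two equal norms. -/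
theorem isClosed_bandSpace (hS : D.crossSection.Nonempty) (I : Set (Fin p → ℝ)) {u : L2R d}
    (hu : ‖u‖ = 1) : IsClosed (bandSpace D I u : Set (L2N D)) := by
  set W := plancherelGraph D ⊓ (fieldSpace D I u).comap (LinearMap.snd ℂ (L2N D) (DirectIntegral D))
    with hW
  have hWc : IsClosed (W : Set (L2N D × DirectIntegral D)) :=
    (isClosed_plancherelGraph D).inter ((isClosed_fieldSpace D I hu).preimage continuous_snd)
  have : CompleteSpace W := hWc.completeSpace_coe
  let T : W →ₗᵢ[ℂ] L2N D :=
    { toLinearMap := (LinearMap.fst ℂ _ _).comp W.subtype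
      norm_map' := fun x => by
        change ‖x.1.1‖ = max ‖x.1.1‖ ‖x.1.2‖
        rw [norm_eq_of_mem_plancherelGraph D hS x.2.1, max_self] }
  have hr : (bandSpace D I u : Set (L2N D)) = Set.range T := by
    ext φ
    constructor
    · rintro ⟨x, hx, rfl⟩
      exact ⟨⟨x, hx⟩, rfl⟩
    · rintro ⟨x, rfl⟩
      exact ⟨x.1, x.2, rfl⟩
  rw [hr]
  exact T.isometry.isClosedEmbedding.isClosed_range

end ExpGroup

theorem det_invDiag (v : Fin d → ℝ) : (invDiag v).det = ∏ i, 1 / v i := by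
  rw [invDiag, Matrix.det_diagonal]

theorem invDiag_mulVec (v w : Fin d → ℝ) : invDiag v *ᵥ w = fun i => w i / v i := by
  ext i
  rw [invDiag, Matrix.mulVec_diagonal]
  ring

namespace ExpGroup

/-! ### The quasi-lattice -/

theorem prod_ofFn_exp {m : ℕ} (v : Fin m → 𝔫) (hv : ∀ i j, ⁅v i, v j⁆ = 0) :
    (List.ofFn fun j => (exp (v j) : ExpGroup D)).prod = exp (∑ j, v j) := by
  induction m with
  | zero => simp; rfl
  | succ m ih =>
    rw [List.ofFn_succ, List.prod_cons, ih (fun j => v j.succ) fun i j => hv _ _, Fin.sum_univ_succ]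
    ext
    simp [log_mul, lie_sum, hv]

theorem prod_exp_eq_mk3 (z : Fin p → ℝ) (y x : Fin d → ℝ) :
    (List.ofFn fun j => (exp (z j • D.Z j) : ExpGroup D)).prod *
      (List.ofFn fun j => (exp (y j • D.Y j) : ExpGroup D)).prod *
      (List.ofFn fun j => (exp (x j • D.X j) : ExpGroup D)).prod = mk3 D (z, y, x) := by
  rw [prod_ofFn_exp, prod_ofFn_exp, prod_ofFn_exp]
  · rfl
  · intro i j
    simp [NilpotentAlgebra.X, D.lie_X_X]
  · intro i j
    simp [NilpotentAlgebra.Y, D.lie_Y_Y]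
  · intro i j
    have hZ : D.Z i = D.sumZ (Pi.single i 1) := by
      simp [NilpotentAlgebra.sumZ, Pi.single_apply, ite_smul]
    rw [smul_lie, hZ, sumZ_lie, smul_zero]

/-- The parametrization of the quasi-lattice by integer vectors `(k, n)` and `m`. -/
def latticePoint (a : Fin p → ℝ) (q b : Fin d → ℝ)
    (i : ((Fin d → ℤ) × (Fin d → ℤ)) × (Fin p → ℤ)) : ExpGroup D :=
  mk3 D (fun j => i.2 j / a j, fun j => i.1.1 j / q j, fun j => i.1.2 j / b j)

theorem coords_latticePoint (a : Fin p → ℝ) (q b : Fin d → ℝ)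
    (i : ((Fin d → ℤ) × (Fin d → ℤ)) × (Fin p → ℤ)) : coords D (latticePoint D a q b i) =
      (fun j => i.2 j / a j, fun j => i.1.1 j / q j, fun j => i.1.2 j / b j) :=
  (coords D).apply_symm_apply _

theorem latticePoint_injective {a : Fin p → ℝ} {q b : Fin d → ℝ} (ha : ∀ k, a k ≠ 0)
    (hq : ∀ j, q j ≠ 0) (hb : ∀ j, b j ≠ 0) : Function.Injective (latticePoint D a q b) := by
  have hdiv : ∀ {m : ℕ} {c : Fin m → ℝ}, (∀ j, c j ≠ 0) → ∀ v w : Fin m → ℤ,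
      (fun j => (v j : ℝ) / c j) = (fun j => (w j : ℝ) / c j) → v = w := by
    intro m c hc v w h
    ext j
    have := congrFun h j
    exact_mod_cast (div_left_inj' (hc j)).1 this
  intro i i' h
  have h' := congrArg (coords D) h
  rw [coords_latticePoint, coords_latticePoint, Prod.mk.injEq, Prod.mk.injEq] at h'
  exact Prod.ext (Prod.ext (hdiv hq _ _ h'.2.1) (hdiv hb _ _ h'.2.2)) (hdiv ha _ _ h'.1)

/-- The quasi-lattice is parametrized by integer vectors. -/
def latticeEquiv {a : Fin p → ℝ} {q b : Fin d → ℝ} (ha : ∀ k, a k ≠ 0)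
    (hq : ∀ j, q j ≠ 0) (hb : ∀ j, b j ≠ 0) :
    ((Fin d → ℤ) × (Fin d → ℤ)) × (Fin p → ℤ) ≃ quasiLattice D a q b :=
  Equiv.ofBijective
    (fun i => ⟨latticePoint D a q b i, i.2, i.1.1, i.1.2, (prod_exp_eq_mk3 D _ _ _).symm⟩) (by
      refine ⟨fun i i' h => latticePoint_injective D ha hq hb (congrArg Subtype.val h), ?_⟩
      rintro ⟨γ, m, k, n, rfl⟩
      exact ⟨((k, n), m), Subtype.ext (prod_exp_eq_mk3 D _ _ _).symm⟩)

/-- The central coordinate acts by a scalar depending on `λ` alone, which separates the Fourier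
index `m` from the Gabor index `(k, n)`. -/
theorem repHS_latticePoint (a : Fin p → ℝ) (q b : Fin d → ℝ) (l : Fin p → ℝ)
    (i : (Fin d → ℤ) × (Fin d → ℤ)) (m : Fin p → ℤ) (T : HS d) :
    repHS D l (latticePoint D a q b (i, m)) T =
      expi ((fun j => (m j : ℝ)) ⬝ᵥ (invDiag a *ᵥ l)) •
        repHS D l (latticePoint D a q b (i, 0)) T := by
  refine Lp.ext ?_
  filter_upwards [coeFn_repHS D l (latticePoint D a q b (i, m)) T,
    coeFn_repHS D l (latticePoint D a q b (i, 0)) T,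
    Lp.coeFn_smul (expi ((fun j => (m j : ℝ)) ⬝ᵥ (invDiag a *ᵥ l)))
      (repHS D l (latticePoint D a q b (i, 0)) T)] with s h1 h2 h3
  rw [h1, h3, Pi.smul_apply, h2, smul_eq_mul, ← mul_assoc, ← expi_add]
  simp only [phase, coords_latticePoint]
  congr 2
  rw [← add_assoc, invDiag_mulVec]
  congr 1
  simp only [dotProduct, Pi.zero_apply, Int.cast_zero, zero_div, mul_zero, Finset.sum_const_zero,
    add_zero]
  refine Finset.sum_congr rfl fun j _ => ?_
  ring

theorem rep_latticePoint_zero (a : Fin p → ℝ) (q b : Fin d → ℝ) (l : Fin p → ℝ)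
    (i : (Fin d → ℤ) × (Fin d → ℤ)) (g : L2R d) :
    rep D l (latticePoint D a q b (i, 0)) g =
      gaborSystem g (invDiag b) (D.B l * invDiag q) i := by
  rw [rep, coords_latticePoint, gaborSystem, ← Matrix.mulVec_mulVec, invDiag_mulVec, invDiag_mulVec]
  simp [dotProduct]

/-! ### Coefficients of the orbit of `η` -/

/-- The function of `λ` whose Fourier coefficients are `⟨v, L(γ)η⟩`, for the Plancherel transforms
`V` and `E` of `v` and `η`. -/
def coeffFun (n : ExpGroup D) (V E : DirectIntegral D) (l : Fin p → ℝ) : ℂ :=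
  ((|(D.B l).det| : ℝ) : ℂ) * inner ℂ (V l) (repHS D l n (E l))

theorem stronglyMeasurable_coeffFun (n : ExpGroup D) (V E : DirectIntegral D) :
    StronglyMeasurable (coeffFun D n V E) := by
  have h1 : StronglyMeasurable fun l => ((|(D.B l).det| : ℝ) : ℂ) :=
    (Complex.continuous_ofReal.comp D.continuous_det_B.abs).stronglyMeasurable
  have h2 : StronglyMeasurable fun l => (l, E l) :=
    stronglyMeasurable_id.prodMk (Lp.stronglyMeasurable E)
  have h3 : StronglyMeasurable fun l => repHS D l n (E l) :=
    Continuous.comp_stronglyMeasurable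
      (g := fun x : (Fin p → ℝ) × HS d => repHS D x.1 n x.2) (f := fun l => (l, E l))
      (continuous_repHS D n) h2
  exact h1.mul ((Lp.stronglyMeasurable V).inner h3)

theorem inner_repField_latticePoint (a : Fin p → ℝ) (q b : Fin d → ℝ)
    (i : (Fin d → ℤ) × (Fin d → ℤ)) (m : Fin p → ℤ) (V E : DirectIntegral D) :
    inner ℂ V (repField D (latticePoint D a q b (i, m)) E) =
      ∫ l, expi ((fun j => (m j : ℝ)) ⬝ᵥ (invDiag a *ᵥ l)) *
        coeffFun D (latticePoint D a q b (i, 0)) V E l := by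
  have e : inner ℂ V (repField D (latticePoint D a q b (i, m)) E) =
      ∫ l, inner ℂ (V l) (repHS D l (latticePoint D a q b (i, m)) (E l))
        ∂D.plancherelMeasure := by
    rw [L2.inner_def]
    refine integral_congr_ae ?_
    filter_upwards [coeFn_repField D (latticePoint D a q b (i, m)) E] with l hl
    rw [hl]
  rw [e, D.integral_plancherelMeasure]
  refine integral_congr_ae (Filter.Eventually.of_forall fun l => ?_)
  simp only [repHS_latticePoint D a q b l i m, inner_smul_right, coeffFun]
  ring

/-- `I` may meet the faces `λ_k = 0` of the closed box, which the half-open cube omits; these faces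
are null. -/
theorem ae_ne_zero_pi : ∀ᵐ l : Fin p → ℝ, ∀ k, l k ≠ 0 :=
  ae_all_iff.2 fun k => Measure.ae_eval_ne (fun _ : Fin p => (volume : Measure ℝ)) k 0

/-- Sum over the lattice of the squared coefficients, given a pointwise Parseval identity. -/
theorem tsum_enorm_sq_inner_repField {a : Fin p → ℝ} (ha : ∀ k, 0 < a k) (q b : Fin d → ℝ)
    {I : Set (Fin p → ℝ)} (hI : ∀ l ∈ I, ∀ k, 0 ≤ l k ∧ l k ≤ a k) {V E : DirectIntegral D}
    (hVI : ∀ᵐ l ∂D.plancherelMeasure, l ∉ I → V l = 0)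
    (hV : ∀ᵐ l ∂D.plancherelMeasure, ∑' i : (Fin d → ℤ) × (Fin d → ℤ),
      ENNReal.ofReal |(D.B l).det| *
        ‖inner ℂ (V l) (repHS D l (latticePoint D a q b (i, 0)) (E l))‖ₑ ^ 2 =
      ENNReal.ofReal (∏ k, a k)⁻¹ * ‖V l‖ₑ ^ 2) :
    ∑' i : ((Fin d → ℤ) × (Fin d → ℤ)) × (Fin p → ℤ),
      ‖inner ℂ V (repField D (latticePoint D a q b i) E)‖ₑ ^ 2 = ‖V‖ₑ ^ 2 := by
  have hpos : 0 < ∏ k, a k := Finset.prod_pos fun k _ => ha k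
  have hsum : ∀ᵐ l, ∑' i : (Fin d → ℤ) × (Fin d → ℤ),
      ‖coeffFun D (latticePoint D a q b (i, 0)) V E l‖ₑ ^ 2 =
      ENNReal.ofReal (∏ k, a k)⁻¹ * (ENNReal.ofReal |(D.B l).det| * ‖V l‖ₑ ^ 2) := by
    filter_upwards [D.ae_plancherelMeasure_iff.1 hV] with l hl
    have e : ‖((|(D.B l).det| : ℝ) : ℂ)‖ₑ = ENNReal.ofReal |(D.B l).det| := by
      rw [← ofReal_norm, Complex.norm_real, Real.norm_of_nonneg (abs_nonneg _)]
    simp_rw [coeffFun, enorm_mul, mul_pow, e]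
    by_cases hdet : (D.B l).det = 0
    · simp [hdet]
    -- Of the two factors `|det B(λ)|`, one belongs to the pointwise identity `hV` and the other is
    -- the Plancherel density.
    · simp_rw [pow_two (ENNReal.ofReal _), mul_assoc]
      rw [ENNReal.tsum_mul_left, hl hdet]
      ring
  have hmeas : Measurable fun l => ENNReal.ofReal |(D.B l).det| * ‖V l‖ₑ ^ 2 :=
    D.measurable_ofReal_abs_det_B.mul ((Lp.stronglyMeasurable V).enorm.pow_const 2)
  have htot : ∑' i : (Fin d → ℤ) × (Fin d → ℤ),
      ∫⁻ l, ‖coeffFun D (latticePoint D a q b (i, 0)) V E l‖ₑ ^ 2 =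
      ENNReal.ofReal (∏ k, a k)⁻¹ * ‖V‖ₑ ^ 2 := by
    rw [← lintegral_tsum fun i =>
      ((stronglyMeasurable_coeffFun D _ V E).enorm.pow_const 2).aemeasurable,
      lintegral_congr_ae hsum, lintegral_const_mul _ hmeas,
      ← D.lintegral_plancherelMeasure ((Lp.stronglyMeasurable V).enorm.pow_const 2),
      lintegral_enorm_sq_Lp]
  have hdet : (invDiag a).det ≠ 0 := by
    rw [det_invDiag]
    exact Finset.prod_ne_zero_iff.2 fun k _ => one_div_ne_zero (ha k).ne'
  have hdet' : |(invDiag a).det|⁻¹ = ∏ k, a k := by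
    rw [det_invDiag, Finset.prod_div_distrib, Finset.prod_const_one, abs_of_pos (by positivity),
      one_div, inv_inv]
  have hfs : ∀ i : (Fin d → ℤ) × (Fin d → ℤ), ∑' m : Fin p → ℤ,
      ‖inner ℂ V (repField D (latticePoint D a q b (i, m)) E)‖ₑ ^ 2 =
      ENNReal.ofReal (∏ k, a k) *
        ∫⁻ l, ‖coeffFun D (latticePoint D a q b (i, 0)) V E l‖ₑ ^ 2 := fun i => by
    simp_rw [inner_repField_latticePoint]
    rw [← hdet']
    refine tsum_enorm_sq_integral_expi hdet 0 ?_ ?_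
    · refine memLp_two_of_lintegral_ne_top
        (stronglyMeasurable_coeffFun D _ V E).aestronglyMeasurable ?_
      -- Each coefficient function is square integrable as one term of the finite total `htot`.
      refine ne_top_of_le_ne_top ?_ (ENNReal.le_tsum (f := fun i =>
        ∫⁻ l, ‖coeffFun D (latticePoint D a q b (i, 0)) V E l‖ₑ ^ 2) i)
      rw [htot]
      exact ENNReal.mul_ne_top ENNReal.ofReal_ne_top (ENNReal.pow_ne_top enorm_ne_top)
    · filter_upwards [D.ae_plancherelMeasure_iff.1 hVI, ae_ne_zero_pi] with l h1 h2 h3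
      by_cases hdet : (D.B l).det = 0
      · simp [coeffFun, hdet]
      · have hlI : l ∉ I := fun hlI => h3 fun k => by
          rw [invDiag_mulVec]
          have h4 := hI l hlI k
          refine ⟨div_pos (lt_of_le_of_ne h4.1 (h2 k).symm) (ha k), ?_⟩
          simpa [div_le_one (ha k)] using h4.2
        simp [coeffFun, h1 hdet hlI]
  rw [ENNReal.tsum_prod (f := fun i m =>
    ‖inner ℂ V (repField D (latticePoint D a q b (i, m)) E)‖ₑ ^ 2)]
  simp_rw [hfs]
  rw [ENNReal.tsum_mul_left, htot, ← mul_assoc, ← ENNReal.ofReal_mul hpos.le,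
    mul_inv_cancel₀ hpos.ne', ENNReal.ofReal_one, one_mul]

/-- Compactness of the box bounds the values, so the real `sSup` is a true supremum and not the
default `0`. Positivity makes `A(b(s))` invertible and the lattice parametrization injective. -/
theorem sSupDet_pos {a : Fin p → ℝ} {I : Set (Fin p → ℝ)} (hI_ne : I.Nonempty)
    (hI : I ⊆ {l | l ∈ D.crossSection ∧ ∀ k, 0 ≤ l k ∧ l k ≤ a k}) : 0 < sSupDet D I := by
  obtain ⟨l, hl⟩ := hI_ne
  refine lt_of_lt_of_le (abs_pos.2 (hI hl).1) (le_csSup ?_ ⟨l, hl, rfl⟩)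
  have hc : IsCompact (Set.Icc 0 a) := isCompact_Icc
  refine (hc.bddAbove_image D.continuous_det_B.abs.continuousOn).mono (Set.image_mono ?_)
  exact fun l hl => ⟨fun k => ((hI hl).2 k).1, fun k => ((hI hl).2 k).2⟩

theorem norm_leftRegular (γ : ExpGroup D) (φ : L2N D) : ‖leftRegular D γ φ‖ = ‖φ‖ :=
  (leftRegular D γ).norm_map φ

/-- `π_λ(γ)` acts on the first tensor factor only, so `u` and the support `I` are preserved. -/
theorem leftRegular_mem_bandSpace (γ : ExpGroup D) {I : Set (Fin p → ℝ)} {u : L2R d} {φ : L2N D}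
    (hφ : φ ∈ bandSpace D I u) : leftRegular D γ φ ∈ bandSpace D I u := by
  obtain ⟨⟨φ', Φ⟩, ⟨hx, hΦ⟩, rfl⟩ := hφ
  refine ⟨(leftRegular D γ φ', repField D γ Φ), ⟨isPlancherelTransform_leftRegular D hx γ, ?_⟩, rfl⟩
  change ∀ᵐ l ∂D.plancherelMeasure, _
  filter_upwards [hΦ, coeFn_repField D γ Φ] with l h1 h2
  change (l ∈ I → repField D γ Φ l ∈ _) ∧ (l ∉ I → repField D γ Φ l = 0)
  rw [h2]
  refine ⟨fun hl => ?_, fun hl => ?_⟩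
  · obtain ⟨f, hf⟩ := h1.1 hl
    exact ⟨rep D l γ f, (repHS_tensor D l γ f u).symm.trans (congrArg (repHS D l γ) hf)⟩
  · have := h1.2 hl
    change Φ l = 0 at this
    rw [this, map_zero]

end ExpGroup

end BandLimited

end

/-! ### The main theorem -/

open BandLimited BandLimited.ExpGroup in
theorem mainTheorem3 {p d : ℕ} (hd : 1 ≤ d) {𝔫 : Type*} [LieRing 𝔫] [LieAlgebra ℝ 𝔫]
    (D : NilpotentAlgebra p d 𝔫)
    (a : Fin p → ℝ) (ha : ∀ k, 0 < a k) (q : Fin d → ℝ) (hq : ∀ j, 0 < q j)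
    (I : Set (Fin p → ℝ)) (hI_meas : MeasurableSet I) (hI_ne : I.Nonempty)
    (hI : I ⊆ {l | l ∈ D.crossSection ∧ ∀ k, 0 ≤ l k ∧ l k ≤ a k})
    (u : L2R d) (hu : ‖u‖ = 1)
    (g : (Fin p → ℝ) → L2R d)
    (hg : ∀ᵐ l ∂D.plancherelMeasure, l ∈ I →
      IsParsevalFrame (gaborSystem (g l) (invDiag (bVec D I)) (D.B l * invDiag q)) ⊤)
    (η : L2N D) (hη : η ∈ bandSpace D I u)
    (ηhat : DirectIntegral D) (hηhat : IsPlancherelTransform D η ηhat)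
    (hform : ∀ᵐ l ∂D.plancherelMeasure, l ∈ I →
      ηhat l = (((∏ k, √(a k)) * √|(D.B l).det| : ℝ) : ℂ)⁻¹ • tensor (g l) u) :
    IsParsevalFrame
        (fun γ : quasiLattice D a q (bVec D I) => leftRegular D (γ : ExpGroup D) η)
        (bandSpace D I u) ∧
      (D.plancherelMeasure I =
          ENNReal.ofReal ((∏ k, a k) / |(invDiag q).det * (invDiag (bVec D I)).det|) →
        IsONB
          (fun γ : quasiLattice D a q (bVec D I) => leftRegular D (γ : ExpGroup D) η)
          (bandSpace D I u)) := by
  set b := bVec D I with hb_def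
  have hb : ∀ j, 0 < b j := fun j => Real.rpow_pos_of_pos (sSupDet_pos D hI_ne hI) _
  have hS : D.crossSection.Nonempty := hI_ne.mono fun l hl => (hI hl).1
  have hapos : 0 < ∏ k, a k := Finset.prod_pos fun k _ => ha k
  have hnorm : ∀ l ∈ I, ‖(((∏ k, √(a k)) * √|(D.B l).det| : ℝ) : ℂ)⁻¹‖ₑ ^ 2 =
      ENNReal.ofReal ((∏ k, a k)⁻¹ * |(D.B l).det|⁻¹) := fun l hl => by
    rw [enorm_sq_eq_ofReal, norm_inv, Complex.norm_real, inv_pow, Real.norm_eq_abs, sq_abs,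
      mul_pow, Real.sq_sqrt (abs_nonneg _), ← Finset.prod_pow]
    simp_rw [Real.sq_sqrt (ha _).le]
    rw [mul_inv]
  have hframe : IsParsevalFrame
      (fun γ : quasiLattice D a q b => leftRegular D (γ : ExpGroup D) η) (bandSpace D I u) := by
    refine ⟨fun γ => leftRegular_mem_bandSpace D γ hη, fun v hv => ?_⟩
    obtain ⟨⟨v, V⟩, ⟨hvV, hVF⟩, rfl⟩ := hv
    change HasSum (fun γ : quasiLattice D a q b => ‖inner ℂ v (leftRegular D γ η)‖ ^ 2) (‖v‖ ^ 2)
    rw [hasSum_norm_sq_iff (by positivity), ← enorm_sq_eq_ofReal,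
      ← (latticeEquiv D (fun k => (ha k).ne') (fun j => (hq j).ne') fun j => (hb j).ne').tsum_eq]
    have hvn : ‖v‖ₑ = ‖V‖ₑ := by
      rw [← ofReal_norm, ← ofReal_norm]
      exact congrArg _ (norm_eq_of_mem_plancherelGraph D hS hvV).symm
    rw [hvn, ← tsum_enorm_sq_inner_repField D ha q b (E := ηhat) (fun l hl => (hI hl).2)
      (by filter_upwards [hVF] with l hl using hl.2)]
    · refine tsum_congr fun i => ?_
      congr 2
      exact inner_eq_of_mem_plancherelGraph D hS hvV
        (isPlancherelTransform_leftRegular D hηhat (latticePoint D a q b i))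
    -- Fibrewise identity: on `I` it is the Gabor frame identity for `f` with `V(λ) = f ⊗ u`, the
    -- scalar in `η̂` supplying `1 / (∏ a_k |det B(λ)|)`; off `I` both sides vanish.
    · filter_upwards [hVF, hg, hform] with l h1 h2 h3
      by_cases hl : l ∈ I
      · obtain ⟨f, hf⟩ := h1.1 hl
        have hf' : V l = tensor f u := hf.symm
        have hdet : 0 < |(D.B l).det| := abs_pos.2 (hI hl).1
        have hs := (hasSum_norm_sq_iff (by positivity)).1 ((h2 hl).2 f Submodule.mem_top)
        rw [← enorm_sq_eq_ofReal] at hs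
        have e : ‖V l‖ₑ = ‖f‖ₑ := by
          rw [← ofReal_norm, ← ofReal_norm, hf', norm_tensor, hu, mul_one]
        have huu : inner ℂ u u = 1 := by
          rw [inner_self_eq_norm_sq_to_K, hu]
          simp
        rw [e, ← hs, ← ENNReal.tsum_mul_left]
        refine tsum_congr fun i => ?_
        rw [h3 hl, map_smul, repHS_tensor, rep_latticePoint_zero, inner_smul_right, hf',
          inner_tensor_tensor, huu, mul_one, enorm_mul, mul_pow, hnorm l hl, ← mul_assoc,
          ← ENNReal.ofReal_mul hdet.le]
        congr 2
        field_simp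
      · have h4 : V l = 0 := h1.2 hl
        simp [h4]
  refine ⟨hframe, fun hμ => hframe.isONB (fun γ => ?_) (isClosed_bandSpace D hS I hu)⟩
  rw [norm_leftRegular]
  obtain ⟨⟨η, E⟩, ⟨hηE, hEF⟩, rfl⟩ := hη
  change ‖η‖ = 1
  -- Two transforms of `η` differ by a transform of `0`, which has norm zero.
  have hE : E = ηhat := by
    have h := norm_eq_of_mem_plancherelGraph D hS (Submodule.sub_mem _ hηE hηhat)
    simpa [sub_eq_zero] using h
  subst hE
  have hA : (invDiag b).det ≠ 0 := by
    rw [det_invDiag]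
    exact Finset.prod_ne_zero_iff.2 fun k _ => one_div_ne_zero (hb k).ne'
  have hQ : (invDiag q).det ≠ 0 := by
    rw [det_invDiag]
    exact Finset.prod_ne_zero_iff.2 fun k _ => one_div_ne_zero (hq k).ne'
  -- The constant value of `‖η̂(λ)‖²` on `I`: the window has `‖g(λ)‖² = |det A(b)| |det B(λ)| |det
  -- D(q)|`, and `|det B(λ)|` cancels. Then `‖η‖² = κ μ(I) = 1`.
  set κ : ℝ := |(invDiag q).det * (invDiag b).det| / ∏ k, a k with hκ
  have hκpos : 0 < κ := div_pos (abs_pos.2 (mul_ne_zero hQ hA)) hapos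
  have key : ∀ᵐ l ∂D.plancherelMeasure, ‖E l‖ₑ ^ 2 = I.indicator (fun _ => ENNReal.ofReal κ) l := by
    filter_upwards [hEF, hg, hform] with l h1 h2 h3
    by_cases hl : l ∈ I
    · have hdet : (D.B l).det ≠ 0 := (hI hl).1
      have hdet' : 0 < |(D.B l).det| := abs_pos.2 hdet
      have hgn := (h2 hl).enorm_sq_gabor hA (by rw [Matrix.det_mul]; exact mul_ne_zero hdet hQ)
      have e : ‖tensor (g l) u‖ₑ = ‖g l‖ₑ := by
        rw [← ofReal_norm, ← ofReal_norm, norm_tensor, hu, mul_one]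
      rw [Set.indicator_of_mem hl, h3 hl, enorm_smul, mul_pow, hnorm l hl, e, hgn,
        ← ENNReal.ofReal_mul (by positivity), hκ, Matrix.det_mul, abs_mul, abs_mul]
      congr 1
      field_simp
    · have h4 : E l = 0 := h1.2 hl
      simp [h4, hl]
  have h1 : ‖η‖ₑ ^ 2 = 1 := by
    have hηn : ‖η‖ₑ = ‖E‖ₑ := by
      rw [← ofReal_norm, ← ofReal_norm]
      exact congrArg _ (norm_eq_of_mem_plancherelGraph D hS hηE).symm
    rw [hηn, ← lintegral_enorm_sq_Lp, lintegral_congr_ae key, lintegral_indicator_const hI_meas, hμ,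
      ← ENNReal.ofReal_mul hκpos.le, hκ, div_mul_div_cancel₀ hapos.ne',
      div_self (abs_pos.2 (mul_ne_zero hQ hA)).ne', ENNReal.ofReal_one]
  rw [enorm_sq_eq_ofReal, ENNReal.ofReal_eq_one] at h1
  exact (pow_eq_one_iff_of_nonneg (norm_nonneg _) two_ne_zero).1 h1
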